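/- Let $d\in\mathbb N$, let $\pi(x,\omega)g(t)=g(t-x)e^{2\pi i\langle\omega,t\rangle}$ be the time-frequency shifts on $L^2(\mathbb R^d)$, and let $\mathcal S^2$ be the Hilbert–Schmidt operators on $L^2(\mathbb R^d)$, with $\langle A,B\rangle=\mathrm{tr}(AB^*)$. For $S,T\in\mathcal S^2$ put $\mathfrak V_ST(z)=S^*\pi(z)^*T$, $z\in\mathbb R^{2d}$, and let $\mathfrak V_S(\mathcal S^2)=\{\mathfrak V_ST: T\in\mathcal S^2\}\subset L^2(\mathbb R^{2d};\mathcal S^2)$ be the quantum Gabor space, with reproducing kernel $K_S(z,z')=\|S\|_{\mathcal S^2}^{-2}\,S^*\pi(z)^*\pi(z')S$ (and $K_S=0$ if $S=0$) and inner product $\int_{\mathbb R^{2d}}\mathrm{tr}(\psi(z)\varphi(z)^*)\,dz$. Let $S_0'(\mathbb R^{2d})$ be the dual of Feichtinger's algebra $S_0(\mathbb R^{2d})$, and let $FG(\mathbb R^{2d})$ be the class of all $F\in S_0'(\mathbb R^{2d})$ for which there is a Schwartz function $\Phi\neq0$ on $\mathbb R^{2d}$ such that for every $R>0$, $\lim_{|x|\to\infty}\sup_{|\omega|<R}|V_\Phi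 F(x,\omega)|=0$, where $V_\Phi F(x,\omega)=\langle F,\pi(x,\omega)\Phi\rangle$. For $F\in S_0'(\mathbb R^{2d})$ and $h\in L^1(\mathbb R^{2d})$, the integral $\int F(z)h(z)\,dz$ is understood in the sense of distributions, as $\lim_{N\to\infty}\int (F*\chi_N)(z)h(z)\,dz$ with $\chi_N(z)=N^{2d}\chi(Nz)$, provided that the limit exists and is the same for all Schwartz functions $\chi$ with $\int\chi=1$ (for $F\in L^\infty$ this is the ordinary integral, and for $h\in S_0$ the duality pairing). Let $S\in\mathcal S^2$ and $F\in FG(\mathbb R^{2d})$ be such that the Toeplitz operator $T_F$ on $\mathfrak V_S(\mathcal S^2)$ is defined, that is: $F\in L^\infty(\mathbb R^{2d})$ (with no further condition on $S$), or, more generally, $\int F(z)\,\mathrm{tr}(\psi(z)\varphi(z)^*)\,dz$ exists in the sense of distributions for all $\psi,\varphi\in\mathfrak V_S(\mathcal S^2)$. Here $$T_F\psi(z)=\int_{\mathbb R^{2d}}F(z')\,K_S(z,z')\psi(z')\,dz'\qquad(\psi\in\mathfrak V_S(\mathcal S^2)),$$ as a weak integral of operators. Let $\{F_n\}_{n\in\mathbb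 N_0^d}$ be a family in $\mathfrak V_S(\mathcal S^2)$. Then $\{F_n\}$ is an eigenbasis of $T_F$ (an orthonormal basis of $\mathfrak V_S(\mathcal S^2)$ consisting of eigenfunctions of $T_F$) if and only if it is complete in $\mathfrak V_S(\mathcal S^2)$ (its linear span is dense) and there are $c_n\in\mathbb C$ such that for all $n,m\in\mathbb N_0^d$ $$\int_{\mathbb R^{2d}}\mathrm{tr}\big(F_n(z)F_m(z)^*\big)\,dz=\delta_{n,m},\qquad \int_{\mathbb R^{2d}}F(z)\,\mathrm{tr}\big(F_n(z)F_m(z)^*\big)\,dz=c_n\delta_{n,m}.$$ In that case the eigenvalue of $F_n$ is $c_n$: for all $n$ and all $\lambda\in\mathbb C$, $T_FF_n=\lambda F_n$ if and only if $\lambda=c_n$. -/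

import Mathlib

open MeasureTheory Filter Topology
open scoped SchwartzMap InnerProductSpace ComplexConjugate ENNReal NNReal

namespace QGabor

noncomputable section

/-! ### Mild distributions and the Fernández–Galbis class on `ℝ^ι` -/

section Distributions

variable {ι : Type} [Fintype ι]

/-- The standard Gaussian `φ₀(t) = 2^{n/4} e^{-π |t|²}` on `ℝ^ι`, `n = |ι|`. -/
def gaussian (t : EuclideanSpace ℝ ι) : ℂ :=
  (((2 : ℝ) ^ ((Fintype.card ι : ℝ) / 4) * Real.exp (-Real.pi * ‖t‖ ^ 2) : ℝ) : ℂ)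

/-- The character `t ↦ e^{-2πi⟨ω, t⟩}`. -/
def character (ω t : EuclideanSpace ℝ ι) : ℂ :=
  Complex.exp (Complex.I * ((-(2 * Real.pi) * ⟪ω, t⟫_ℝ : ℝ) : ℂ))

/-- The short-time Fourier transform
`V_g f (x, ω) = ∫ f(t) conj(g(t - x)) e^{-2πi⟨ω, t⟩} dt`. -/
def stft (g f : EuclideanSpace ℝ ι → ℂ) (x ω : EuclideanSpace ℝ ι) : ℂ :=
  ∫ t, f t * conj (g (t - x)) * character ω t

/-- The norm of Feichtinger's algebra `S₀`: the `L¹`-norm of `V_{φ₀} f`. -/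
def feichtingerNorm (f : EuclideanSpace ℝ ι → ℂ) : ℝ≥0∞ :=
  ∫⁻ x, ∫⁻ ω, ‖stft gaussian f x ω‖ₑ

/-- Mild distributions, i.e. elements of the dual space `S₀'`: since the Schwartz functions are
dense in `S₀`, these are the tempered distributions that are bounded for the norm of `S₀`. -/
def IsMild (G : 𝓢'(EuclideanSpace ℝ ι, ℂ)) : Prop :=
  ∃ C : ℝ≥0, ∀ f : 𝓢(EuclideanSpace ℝ ι, ℂ), ‖G f‖ₑ ≤ C * feichtingerNorm f

theorem character_hasTemperateGrowth (ω : EuclideanSpace ℝ ι) :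
    (character ω).HasTemperateGrowth := by
  have h1 : (fun s : ℝ => Complex.exp (Complex.I * (s : ℂ))).HasTemperateGrowth := by
    refine ⟨?_, fun n => ⟨0, 1, fun s => ?_⟩⟩
    · exact (contDiff_const.mul Complex.ofRealCLM.contDiff).cexp
    · have hd : ∀ n : ℕ, iteratedDeriv n (fun s : ℝ => Complex.exp (Complex.I * (s : ℂ)))
          = fun s : ℝ => Complex.I ^ n * Complex.exp (Complex.I * (s : ℂ)) := by
        intro n
        induction n with
        | zero => simp
        | succ n ih =>
          rw [iteratedDeriv_succ, ih]
          funext s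
          have h : HasDerivAt (fun s : ℝ => Complex.exp (Complex.I * (s : ℂ)))
              (Complex.exp (Complex.I * (s : ℂ)) * (Complex.I * 1)) s :=
            ((Complex.ofRealCLM.hasDerivAt (x := s)).const_mul Complex.I).cexp
          rw [(h.const_mul (Complex.I ^ n)).deriv]
          ring
      rw [norm_iteratedFDeriv_eq_norm_iteratedDeriv, hd]
      simp [mul_comm Complex.I, Complex.norm_exp_ofReal_mul_I]
  have h2 : (fun t : EuclideanSpace ℝ ι => -(2 * Real.pi) * ⟪ω, t⟫_ℝ).HasTemperateGrowth := by
    have := Function.hasTemperateGrowth_inner_right ω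
    fun_prop
  exact h1.comp h2

/-- The Schwartz function `conj (π(x, ω) Φ)`, i.e. `t ↦ e^{-2πi⟨ω, t⟩} conj(Φ(t - x))`. -/
def conjShift (Φ : 𝓢(EuclideanSpace ℝ ι, ℂ)) (x ω : EuclideanSpace ℝ ι) :
    𝓢(EuclideanSpace ℝ ι, ℂ) :=
  SchwartzMap.smulLeftCLM ℂ (character ω)
    (SchwartzMap.compSubConstCLM ℝ x
      (SchwartzMap.postcompCLM (𝕜 := ℝ) (Complex.conjCLE : ℂ →L[ℝ] ℂ) Φ))

theorem conjShift_apply (Φ : 𝓢(EuclideanSpace ℝ ι, ℂ)) (x ω t : EuclideanSpace ℝ ι) :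
    conjShift Φ x ω t = character ω t * conj (Φ (t - x)) := by
  simp [conjShift, SchwartzMap.smulLeftCLM_apply_apply (character_hasTemperateGrowth ω)]

/-- The short-time Fourier transform `V_Φ G (x, ω) = ⟨G, π(x, ω) Φ⟩` of a tempered distribution
with a Schwartz window (`⟨·, ·⟩` is antilinear in its second argument, `G` itself is linear). -/
def distStft (Φ : 𝓢(EuclideanSpace ℝ ι, ℂ)) (G : 𝓢'(EuclideanSpace ℝ ι, ℂ))
    (x ω : EuclideanSpace ℝ ι) : ℂ :=
  G (conjShift Φ x ω)

/-- The Fernández–Galbis class: mild distributions `G` for which there is a Schwartz window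
`Φ ≠ 0` such that for all `R > 0`, `sup_{|ω| < R} |V_Φ G (x, ω)| → 0` as `|x| → ∞`. -/
def FG (ι : Type) [Fintype ι] : Set (𝓢'(EuclideanSpace ℝ ι, ℂ)) :=
  {G | IsMild G ∧ ∃ Φ : 𝓢(EuclideanSpace ℝ ι, ℂ), Φ ≠ 0 ∧ ∀ R : ℝ, 0 < R →
    TendstoUniformlyOn (fun x ω => distStft Φ G x ω) (fun _ => 0)
      (cocompact (EuclideanSpace ℝ ι)) (Metric.ball 0 R)}

/-- `F` is (integration against) a function in `L^∞`. -/
def IsBoundedFunction (F : 𝓢'(EuclideanSpace ℝ ι, ℂ)) : Prop :=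
  ∃ f : EuclideanSpace ℝ ι → ℂ, MemLp f ∞ ∧
    ∀ φ : 𝓢(EuclideanSpace ℝ ι, ℂ), F φ = ∫ z, f z * φ z

/-- For `N = k + 1` and `χ_N(t) = N^n χ(N t)`, the Schwartz function `t ↦ χ_N(z - t)`. -/
def mollifierAt (χ : 𝓢(EuclideanSpace ℝ ι, ℂ)) (k : ℕ) (z : EuclideanSpace ℝ ι) :
    𝓢(EuclideanSpace ℝ ι, ℂ) :=
  ((k : ℂ) + 1) ^ Fintype.card ι •
    SchwartzMap.compSubConstCLM ℂ z
      (SchwartzMap.compCLMOfContinuousLinearEquiv ℂ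
        (ContinuousLinearEquiv.smulLeft
          (Units.mk0 (-((k : ℝ) + 1)) (neg_ne_zero.mpr k.cast_add_one_ne_zero))) χ)

theorem mollifierAt_apply (χ : 𝓢(EuclideanSpace ℝ ι, ℂ)) (k : ℕ) (z t : EuclideanSpace ℝ ι) :
    mollifierAt χ k z t = ((k : ℂ) + 1) ^ Fintype.card ι * χ (((k : ℝ) + 1) • (z - t)) := by
  have : -((k : ℝ) + 1) • (t - z) = ((k : ℝ) + 1) • (z - t) := by
    rw [neg_smul, ← smul_neg, neg_sub]
  simp [mollifierAt, ← this, Units.smul_def]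

/-- The convolution `F * χ_N`, `N = k + 1`; a smooth function, bounded if `F` is mild. -/
def regularization (F : 𝓢'(EuclideanSpace ℝ ι, ℂ)) (χ : 𝓢(EuclideanSpace ℝ ι, ℂ)) (k : ℕ)
    (z : EuclideanSpace ℝ ι) : ℂ :=
  F (mollifierAt χ k z)

/-- The integral `∫ F(z) h(z) dz` of an `L¹` function `h` against a mild distribution `F`, in the
sense of distributions: `∫ (F * χ_N)(z) h(z) dz → c` as `N → ∞`, for every `χ ∈ 𝓢` with `∫ χ = 1`.
It is the ordinary integral if `F` is a function in `L^∞`, and the duality pairing of `S₀'` and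
`S₀` if `h ∈ S₀`. -/
def HasDistribIntegral (F : 𝓢'(EuclideanSpace ℝ ι, ℂ)) (h : EuclideanSpace ℝ ι → ℂ) (c : ℂ) :
    Prop :=
  Integrable h ∧ ∀ χ : 𝓢(EuclideanSpace ℝ ι, ℂ), ∫ t, χ t = 1 →
    Tendsto (fun k : ℕ => ∫ z, regularization F χ k z * h z) atTop (𝓝 c)

end Distributions

/-! ### Trace and Hilbert–Schmidt operators -/

section HilbertSchmidt

variable (H : Type*) [NormedAddCommGroup H] [InnerProductSpace ℂ H] [CompleteSpace H]

/-- The index set of a fixed orthonormal basis of `H`. -/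
def basisIndex : Set H := (exists_hilbertBasis ℂ H).choose

/-- A fixed orthonormal basis of `H`; the notions below do not depend on it. -/
def onb : HilbertBasis (basisIndex H) ℂ H := (exists_hilbertBasis ℂ H).choose_spec.choose

variable {H}

/-- The trace `∑ ⟨A e_i, e_i⟩`. -/
def tr (A : H →L[ℂ] H) : ℂ := ∑' i, ⟪onb H i, A (onb H i)⟫_ℂ

/-- Hilbert–Schmidt operators: `∑ ‖A e_i‖² < ∞`. -/
def IsHilbertSchmidt (A : H →L[ℂ] H) : Prop := Summable fun i => ‖A (onb H i)‖ ^ 2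

end HilbertSchmidt

/-! ### Time-frequency shifts -/

/-- `L²(ℝ^d)`. -/
abbrev L2 (d : ℕ) : Type := Lp ℂ 2 (volume : Measure (EuclideanSpace ℝ (Fin d)))

/-- The time-frequency plane `ℝ^{2d}`. -/
abbrev PhaseSpace (d : ℕ) : Type := EuclideanSpace ℝ (Fin d ⊕ Fin d)

variable {d : ℕ}

/-- The component `x` of `z = (x, ω)`. -/
def position (z : PhaseSpace d) : EuclideanSpace ℝ (Fin d) :=
  WithLp.toLp 2 fun i => z (Sum.inl i)

/-- The component `ω` of `z = (x, ω)`. -/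
def frequency (z : PhaseSpace d) : EuclideanSpace ℝ (Fin d) :=
  WithLp.toLp 2 fun i => z (Sum.inr i)

/-- `(π(x, ω) g)(t) = g(t - x) e^{2πi⟨ω, t⟩}` for functions. -/
def shiftFun (z : PhaseSpace d) (g : EuclideanSpace ℝ (Fin d) → ℂ)
    (t : EuclideanSpace ℝ (Fin d)) : ℂ :=
  g (t - position z) * Complex.exp (((2 * Real.pi * ⟪frequency z, t⟫_ℝ : ℝ) : ℂ) * Complex.I)

theorem shiftFun_congr (z : PhaseSpace d) {f g : EuclideanSpace ℝ (Fin d) → ℂ}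
    (h : f =ᵐ[volume] g) : shiftFun z f =ᵐ[volume] shiftFun z g := by
  have := (measurePreserving_sub_right volume (position z)).quasiMeasurePreserving.ae_eq_comp h
  filter_upwards [this] with t ht
  simp only [Function.comp_apply] at ht
  simp only [shiftFun, ht]

theorem memLp_shiftFun (z : PhaseSpace d) (g : L2 d) :
    MemLp (shiftFun z g) 2 volume := by
  have h1 : MemLp (fun t => g (t - position z)) 2 volume :=
    (Lp.memLp g).comp_measurePreserving (measurePreserving_sub_right volume (position z))
  have hc : Continuous fun t : EuclideanSpace ℝ (Fin d) =>
      Complex.exp (((2 * Real.pi * ⟪frequency z, t⟫_ℝ : ℝ) : ℂ) * Complex.I) := by fun_prop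
  refine h1.of_le (h1.1.mul hc.aestronglyMeasurable) (Eventually.of_forall fun t => ?_)
  rw [shiftFun, norm_mul, Complex.norm_exp_ofReal_mul_I, mul_one]

/-- The time-frequency shift `π(z)` on `L²(ℝ^d)`. -/
def timeFreqShift (z : PhaseSpace d) : L2 d →L[ℂ] L2 d :=
  LinearIsometry.toContinuousLinearMap
    { toFun := fun g => (memLp_shiftFun z g).toLp
      map_add' := fun f g => by
        rw [← MemLp.toLp_add]
        refine (MemLp.toLp_eq_toLp_iff _ _).2 ?_
        filter_upwards [shiftFun_congr z (Lp.coeFn_add f g)] with t ht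
        rw [ht]
        simp [shiftFun, add_mul]
      map_smul' := fun c g => by
        rw [RingHom.id_apply, ← MemLp.toLp_const_smul]
        refine (MemLp.toLp_eq_toLp_iff _ _).2 ?_
        filter_upwards [shiftFun_congr z (Lp.coeFn_smul c g)] with t ht
        rw [ht]
        simp [shiftFun, mul_assoc]
      norm_map' := fun g => by
        change ‖(memLp_shiftFun z g).toLp‖ = ‖g‖
        have h1 : MemLp (fun t => g (t - position z)) 2 volume :=
          (Lp.memLp g).comp_measurePreserving (measurePreserving_sub_right volume (position z))
        rw [Lp.norm_toLp, Lp.norm_def]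
        congr 1
        rw [← eLpNorm_comp_measurePreserving (Lp.aestronglyMeasurable g)
          (measurePreserving_sub_right volume (position z))]
        refine eLpNorm_congr_norm_ae (Eventually.of_forall fun t => ?_)
        rw [shiftFun, norm_mul, Complex.norm_exp_ofReal_mul_I, mul_one]
        rfl }

theorem timeFreqShift_coeFn (z : PhaseSpace d) (g : L2 d) :
    timeFreqShift z g =ᵐ[volume] shiftFun z g :=
  (memLp_shiftFun z g).coeFn_toLp

/-! ### Quantum Gabor spaces and their Toeplitz operators -/

/-- The operator short-time Fourier transform `𝔙_S T (z) = S* π(z)* T`. -/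
def opSTFT (S T : L2 d →L[ℂ] L2 d) (z : PhaseSpace d) : L2 d →L[ℂ] L2 d :=
  S.adjoint ∘L (timeFreqShift z).adjoint ∘L T

/-- The quantum Gabor space `𝔙_S(𝓢²)`. -/
def quantumGaborSpace (S : L2 d →L[ℂ] L2 d) : Set (PhaseSpace d → L2 d →L[ℂ] L2 d) :=
  {ψ | ∃ T : L2 d →L[ℂ] L2 d, IsHilbertSchmidt T ∧ ψ = opSTFT S T}

/-- The function `z ↦ tr(ψ(z) φ(z)*)`. -/
def trPair (ψ φ : PhaseSpace d → L2 d →L[ℂ] L2 d) (z : PhaseSpace d) : ℂ :=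
  tr (ψ z ∘L (φ z).adjoint)

/-- The inner product `∫ tr(ψ(z) φ(z)*) dz` of `L²(ℝ^{2d}; 𝓢²)`. -/
def gaborInner (ψ φ : PhaseSpace d → L2 d →L[ℂ] L2 d) : ℂ := ∫ z, trPair ψ φ z

/-- The reproducing kernel `‖S‖⁻² S* π(z)* π(z') S` of `𝔙_S(𝓢²)`, with `‖S‖² = tr(S S*)`. -/
def kernel (S : L2 d →L[ℂ] L2 d) (z z' : PhaseSpace d) : L2 d →L[ℂ] L2 d :=
  (tr (S ∘L S.adjoint))⁻¹ •
    (S.adjoint ∘L (timeFreqShift z).adjoint ∘L timeFreqShift z' ∘L S)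

/-- `T_F ψ = η`, where `T_F ψ = P_S (F ψ)` is the Toeplitz operator with mask `F`, that is
`η(z) = ∫ F(z') K_S(z, z') ψ(z') dz'` for all `z`, as a weak integral of operators. -/
def IsToeplitzImage (F : 𝓢'(PhaseSpace d, ℂ)) (S : L2 d →L[ℂ] L2 d)
    (ψ η : PhaseSpace d → L2 d →L[ℂ] L2 d) : Prop :=
  ∀ (z : PhaseSpace d) (f g : L2 d),
    HasDistribIntegral F (fun z' => ⟪g, (kernel S z z' ∘L ψ z') f⟫_ℂ) ⟪g, η z f⟫_ℂ

/-- The Toeplitz operator with mask `F` is defined on `𝔙_S(𝓢²)`: either `F` is a function in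
`L^∞`, or the integrals `⟨T_F ψ, φ⟩ = ∫ F(z) tr(ψ(z) φ(z)*) dz`, `ψ, φ ∈ 𝔙_S(𝓢²)`, exist in the
sense of distributions (as they do for every mild `F` if `S` is sufficiently nice). -/
def ToeplitzDefined (F : 𝓢'(PhaseSpace d, ℂ)) (S : L2 d →L[ℂ] L2 d) : Prop :=
  IsBoundedFunction F ∨
    ∀ ψ ∈ quantumGaborSpace S, ∀ φ ∈ quantumGaborSpace S,
      ∃ c : ℂ, HasDistribIntegral F (trPair ψ φ) c

/-- The family `Fn` is complete in `𝔙_S(𝓢²)`: its linear span is dense. -/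
def IsCompleteFamily {κ : Type*} (S : L2 d →L[ℂ] L2 d)
    (Fn : κ → PhaseSpace d → L2 d →L[ℂ] L2 d) : Prop :=
  ∀ ψ ∈ quantumGaborSpace S, ∀ ε : ℝ, 0 < ε →
    ∃ φ ∈ Submodule.span ℂ (Set.range Fn), (gaborInner (ψ - φ) (ψ - φ)).re < ε

/-- The family `Fn` is an eigenbasis of `T_F`: an orthonormal basis of `𝔙_S(𝓢²)` that consists of
eigenfunctions of `T_F`. -/
def IsToeplitzEigenbasis {κ : Type*} [DecidableEq κ] (F : 𝓢'(PhaseSpace d, ℂ))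
    (S : L2 d →L[ℂ] L2 d) (Fn : κ → PhaseSpace d → L2 d →L[ℂ] L2 d) : Prop :=
  (∀ n m, gaborInner (Fn n) (Fn m) = if n = m then 1 else 0) ∧
  IsCompleteFamily S Fn ∧
  ∀ n, ∃ lam : ℂ, IsToeplitzImage F S (Fn n) (lam • Fn n)

/-- Double orthogonality with constants `c`: completeness, `∫ tr(F_n F_m*) = δ_{n,m}` and
`∫ F tr(F_n F_m*) = c_n δ_{n,m}`. -/
def IsDoublyOrthogonal {κ : Type*} [DecidableEq κ] (F : 𝓢'(PhaseSpace d, ℂ))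
    (S : L2 d →L[ℂ] L2 d) (Fn : κ → PhaseSpace d → L2 d →L[ℂ] L2 d) (c : κ → ℂ) : Prop :=
  IsCompleteFamily S Fn ∧
  (∀ n m, ∫ z, trPair (Fn n) (Fn m) z = if n = m then 1 else 0) ∧
  ∀ n m, HasDistribIntegral F (trPair (Fn n) (Fn m)) (if n = m then c n else 0)

end

end QGabor

/-! Through `T ↦ 𝔙_S T` everything is transported to the Hilbert space of Hilbert–Schmidt operators.
Moyal's identity, proved from Plancherel and summed over an orthonormal basis, gives `⟨𝔙_S A, 𝔙_S B⟩
= ‖S‖² ⟨A, B⟩` (`gaborInner_opSTFT`), so `𝔙_S` is a multiple of an isometry and all functions `tr(ψ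
φ*)` are integrable.

The weak integral defining `T_F ψ`, tested at `z` against `f` and `g`, is `‖S‖⁻² ∫ F tr(ψ φ*)` with
`φ = 𝔙_S R`, where `R` is the rank one operator `|π(z) S g⟩⟨f|` (`inner_kernel_comp`). Hence `T_F ψ
= λ ψ` says that `∫ F tr(ψ φ*) = λ ⟨ψ, φ⟩` for these particular `φ`; double orthogonality says the
same for `ψ = F_n`, `λ = c_n` and `φ` in the family. Both sets of test functions span a dense
subspace: the first by Moyal, the second by completeness.

It remains to pass from a dense span to all `φ` (`hasDistribIntegral_of_dense_span`). The integrals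
are limits of the forms with mask `F * χ_N`, so a bound uniform in `N` is needed. It comes from
`‖F‖_∞ ‖χ‖₁` if `F` is bounded, and from Banach–Steinhaus otherwise, since the forms are assumed to
converge pointwise; there mildness makes each single `F * χ_N` bounded, hence each form continuous.
Both conditions thus amount to the identity for all `φ` (`isToeplitzImage_smul_iff`). -/

namespace QGabor

noncomputable section

/-! ### Plancherel for Fourier integrals of functions in `L¹ ∩ L²`. -/

section Plancherel

open FourierTransform

variable {E : Type*} [NormedAddCommGroup E] [InnerProductSpace ℝ E] [FiniteDimensional ℝ E]
  [MeasurableSpace E] [BorelSpace E]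

/-- The Fourier integral of an integrable `L²` function is its `L²` Fourier transform. -/
theorem fourierIntegral_ae_eq_fourier_toLp {f : E → ℂ} (h1 : Integrable f) (h2 : MemLp f 2) :
    𝓕 f =ᵐ[volume] (𝓕 (h2.toLp f) : Lp ℂ 2 (volume : Measure E)) := by
  have hcont : Continuous (𝓕 f) :=
    VectorFourier.fourierIntegral_continuous Real.continuous_fourierChar
      (by exact continuous_inner) h1
  -- Both functions are locally integrable, so it suffices to test against smooth compactly
  -- supported `g`. The multiplication formula turns either pairing into `∫ 𝓕g · f`.
  refine ae_eq_of_integral_contDiff_smul_eq hcont.locallyIntegrable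
    ((Lp.memLp _).locallyIntegrable one_le_two) fun g hg hgs => ?_
  have hgc : HasCompactSupport (fun x => (g x : ℂ)) := hgs.comp_left Complex.ofReal_zero
  let φ : 𝓢(E, ℂ) := hgc.toSchwartzMap (Complex.ofRealCLM.contDiff.comp hg)
  have hφ : ∀ x, φ x = g x := fun x => rfl
  have e1 : ∫ x, g x • (𝓕 (h2.toLp f) : Lp ℂ 2 (volume : Measure E)) x
      = ∫ x, (𝓕 φ) x • f x := by
    have := congrArg (fun T : 𝓢'(E, ℂ) => T φ)
      (Lp.fourier_toTemperedDistribution_eq (h2.toLp f))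
    simp only [TemperedDistribution.fourier_apply, Lp.toTemperedDistribution_apply] at this
    rw [show ∫ x, g x • (𝓕 (h2.toLp f) : Lp ℂ 2 (volume : Measure E)) x
      = ∫ x, φ x • (𝓕 (h2.toLp f) : Lp ℂ 2 (volume : Measure E)) x from
        integral_congr_ae (Eventually.of_forall fun x => by simp [hφ]), ← this]
    refine integral_congr_ae ?_
    filter_upwards [h2.coeFn_toLp] with x hx
    rw [hx]
  rw [e1]
  have e2 := VectorFourier.integral_fourierIntegral_smul_eq_flip (L := innerₗ E) (μ := volume)
    (ν := volume) (f := f) (g := φ) Real.continuous_fourierChar continuous_inner h1 φ.integrable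
  rw [flip_innerₗ] at e2
  calc ∫ x, g x • 𝓕 f x = ∫ x, 𝓕 f x • φ x :=
        integral_congr_ae (Eventually.of_forall fun x => by simp [hφ, mul_comm])
    _ = ∫ x, f x • 𝓕 (φ : E → ℂ) x := e2
    _ = _ := integral_congr_ae (Eventually.of_forall fun x => by
        simp [SchwartzMap.fourier_coe, mul_comm])

theorem lintegral_enorm_sq_coeFn (u : Lp ℂ 2 (volume : Measure E)) :
    ∫⁻ x, ‖u x‖ₑ ^ 2 = ‖u‖ₑ ^ 2 := by
  rw [Lp.enorm_def, eLpNorm_eq_lintegral_rpow_enorm_toReal two_ne_zero ENNReal.ofNat_ne_top,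
    ← ENNReal.rpow_natCast, ← ENNReal.rpow_mul]
  simp

theorem lintegral_enorm_sq_fourierIntegral {f : E → ℂ} (h1 : Integrable f) (h2 : MemLp f 2) :
    ∫⁻ x, ‖𝓕 f x‖ₑ ^ 2 = ∫⁻ x, ‖f x‖ₑ ^ 2 := by
  calc ∫⁻ x, ‖𝓕 f x‖ₑ ^ 2
      = ∫⁻ x, ‖(𝓕 (h2.toLp f) : Lp ℂ 2 (volume : Measure E)) x‖ₑ ^ 2 :=
        lintegral_congr_ae ((fourierIntegral_ae_eq_fourier_toLp h1 h2).fun_comp (‖·‖ₑ ^ 2))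
    _ = ‖h2.toLp f‖ₑ ^ 2 := by
        rw [lintegral_enorm_sq_coeFn, enorm_eq_iff_norm_eq.2 (Lp.norm_fourier_eq _)]
    _ = ∫⁻ x, ‖f x‖ₑ ^ 2 := by
        rw [← lintegral_enorm_sq_coeFn]
        exact lintegral_congr_ae (h2.coeFn_toLp.fun_comp (‖·‖ₑ ^ 2))

end Plancherel

/-! ### Moyal's identity for matrix coefficients of time-frequency shifts. -/

section Moyal

variable {d : ℕ}

theorem measurePreserving_position_frequency :
    MeasurePreserving (fun z : PhaseSpace d => (position z, frequency z)) := by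
  have h1 := PiLp.volume_preserving_ofLp (Fin d ⊕ Fin d)
  have h2 := volume_measurePreserving_sumPiEquivProdPi (fun _ : Fin d ⊕ Fin d => ℝ)
  have h3 := (PiLp.volume_preserving_toLp (Fin d)).prod (PiLp.volume_preserving_toLp (Fin d))
  exact h3.comp (h2.comp h1)

-- For fixed position the matrix coefficient is a Fourier transform in the frequency variable, which
-- is where Plancherel enters.
open FourierTransform in
theorem inner_timeFreqShift (z : PhaseSpace d) (a b : L2 d) :
    ⟪timeFreqShift z a, b⟫_ℂ
      = 𝓕 (fun t => b t * conj (a (t - position z))) (frequency z) := by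
  rw [L2.inner_def, Real.fourier_eq']
  refine integral_congr_ae ?_
  filter_upwards [timeFreqShift_coeFn z a] with t ht
  rw [ht, shiftFun, RCLike.inner_apply, map_mul, ← Complex.exp_conj, real_inner_comm]
  simp only [map_mul, Complex.conj_ofReal, Complex.conj_I, smul_eq_mul]
  push_cast
  ring_nf

open FourierTransform in
theorem stronglyMeasurable_fourier_shift (a b : L2 d) :
    StronglyMeasurable fun p : EuclideanSpace ℝ (Fin d) × EuclideanSpace ℝ (Fin d) =>
      𝓕 (fun t => b t * conj (a (t - p.1))) p.2 := by
  have hb := (Lp.stronglyMeasurable b).measurable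
  have ha := (Lp.stronglyMeasurable a).measurable
  have h1 : Measurable fun q : (EuclideanSpace ℝ (Fin d) × EuclideanSpace ℝ (Fin d)) ×
      EuclideanSpace ℝ (Fin d) => Complex.exp (↑(-2 * Real.pi * ⟪q.2, q.1.2⟫_ℝ) * Complex.I) :=
    Continuous.measurable (by fun_prop)
  have h2 : Measurable fun q : (EuclideanSpace ℝ (Fin d) × EuclideanSpace ℝ (Fin d)) ×
      EuclideanSpace ℝ (Fin d) => conj (a (q.2 - q.1.1)) :=
    Complex.continuous_conj.measurable.comp
      (ha.comp (measurable_snd.sub measurable_fst.fst))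
  have h3 := (h1.smul ((hb.comp measurable_snd).mul h2)).stronglyMeasurable.integral_prod_right'
    (ν := volume)
  refine (congrArg StronglyMeasurable (funext fun p => ?_)).mpr h3
  exact Real.fourier_eq' _ _

theorem stronglyMeasurable_inner_timeFreqShift (a b : L2 d) :
    StronglyMeasurable fun z : PhaseSpace d => ⟪timeFreqShift z a, b⟫_ℂ := by
  have h := (stronglyMeasurable_fourier_shift a b).comp_measurable
    (measurePreserving_position_frequency (d := d)).measurable
  exact (congrArg StronglyMeasurable (funext fun z => inner_timeFreqShift z a b)).mpr h

/-- Moyal's identity. -/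
theorem lintegral_enorm_sq_inner_timeFreqShift (a b : L2 d) :
    ∫⁻ z : PhaseSpace d, ‖⟪timeFreqShift z a, b⟫_ℂ‖ₑ ^ 2 = ‖a‖ₑ ^ 2 * ‖b‖ₑ ^ 2 := by
  simp_rw [inner_timeFreqShift]
  have hb := (Lp.stronglyMeasurable b).measurable
  have ha := (Lp.stronglyMeasurable a).measurable
  have hm : Measurable fun p : EuclideanSpace ℝ (Fin d) × EuclideanSpace ℝ (Fin d) =>
      ‖b p.2 * conj (a (p.2 - p.1))‖ₑ ^ 2 :=
    (((hb.comp measurable_snd).mul (Complex.continuous_conj.measurable.comp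
      (ha.comp (measurable_snd.sub measurable_fst)))).enorm).pow_const 2
  have hswap : ∫⁻ x, ∫⁻ t, ‖b t * conj (a (t - x))‖ₑ ^ 2 = ‖a‖ₑ ^ 2 * ‖b‖ₑ ^ 2 := by
    rw [lintegral_lintegral_swap hm.aemeasurable]
    have : ∀ t, ∫⁻ x, ‖b t * conj (a (t - x))‖ₑ ^ 2 = ‖b t‖ₑ ^ 2 * ‖a‖ₑ ^ 2 := fun t => by
      simp_rw [enorm_mul, mul_pow, RCLike.enorm_conj]
      rw [lintegral_const_mul' _ _ (by simp), lintegral_sub_left_eq_self (fun x => ‖a x‖ₑ ^ 2) t,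
        lintegral_enorm_sq_coeFn]
    simp_rw [this]
    rw [lintegral_mul_const' _ _ (by simp), lintegral_enorm_sq_coeFn, mul_comm]
  -- By Tonelli the windowed product is square integrable for almost every shift `x`, so Plancherel
  -- applies in `ω` for almost every `x`.
  have hlt : ∀ᵐ x, ∫⁻ t, ‖b t * conj (a (t - x))‖ₑ ^ 2 < ∞ := by
    refine ae_lt_top hm.lintegral_prod_right ?_
    rw [hswap]
    exact ENNReal.mul_ne_top (by simp) (by simp)
  have hG : Measurable fun p : EuclideanSpace ℝ (Fin d) × EuclideanSpace ℝ (Fin d) =>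
      ‖FourierTransform.fourier (fun t => b t * conj (a (t - p.1))) p.2‖ₑ ^ 2 :=
    (stronglyMeasurable_fourier_shift a b).measurable.enorm.pow_const 2
  rw [(measurePreserving_position_frequency (d := d)).lintegral_comp hG, Measure.volume_eq_prod,
    lintegral_prod _ hG.aemeasurable, ← hswap]
  refine lintegral_congr_ae ?_
  filter_upwards [hlt] with x hx
  have hax : MemLp (fun t => conj (a (t - x))) 2 volume :=
    ((Lp.memLp a).comp_measurePreserving (measurePreserving_sub_right volume x)).star
  have hi : Integrable fun t => b t * conj (a (t - x)) := (Lp.memLp b).integrable_mul hax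
  refine lintegral_enorm_sq_fourierIntegral hi ⟨hi.1, ?_⟩
  rw [eLpNorm_lt_top_iff_lintegral_rpow_enorm_lt_top two_ne_zero ENNReal.ofNat_ne_top]
  simpa using hx

theorem inner_timeFreqShift_eq_zero_imp {a b : L2 d} (ha : a ≠ 0)
    (h : ∀ z : PhaseSpace d, ⟪timeFreqShift z a, b⟫_ℂ = 0) : b = 0 := by
  have := lintegral_enorm_sq_inner_timeFreqShift a b
  simpa [h, ha] using this.symm

end Moyal

/-! ### Hilbert–Schmidt operators as the Hilbert space `ℓ²(basis; H)`. -/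

section HilbertSchmidt

variable {H : Type*} [NormedAddCommGroup H] [InnerProductSpace ℂ H] [CompleteSpace H]

variable (H) in
/-- Hilbert–Schmidt operators, encoded by the images of the vectors of the basis `onb H`. -/
abbrev HSSpace : Type _ := lp (fun _ : basisIndex H => H) 2

theorem hasSum_norm_sq_lp {ι : Type*} {G : ι → Type*} [∀ i, NormedAddCommGroup (G i)]
    (f : lp G 2) : HasSum (fun i => ‖f i‖ ^ 2) (‖f‖ ^ 2) := by
  simpa using lp.hasSum_norm (p := 2) (by norm_num) f

theorem tsum_enorm_sq_lp {ι : Type*} {G : ι → Type*} [∀ i, NormedAddCommGroup (G i)]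
    (f : lp G 2) : ∑' i, ‖f i‖ₑ ^ 2 = ‖f‖ₑ ^ 2 := by
  have h := hasSum_norm_sq_lp f
  have e : ∀ x : ℝ, 0 ≤ x → ENNReal.ofReal (x ^ 2) = ENNReal.ofReal x ^ 2 :=
    fun x hx => ENNReal.ofReal_pow hx 2
  simp_rw [← ofReal_norm, ← e _ (norm_nonneg _)]
  rw [← h.tsum_eq, ENNReal.ofReal_tsum_of_nonneg (fun i => by positivity) h.summable]

theorem hasSum_norm_sq_inner_onb (x : H) :
    HasSum (fun i => ‖⟪onb H i, x⟫_ℂ‖ ^ 2) (‖x‖ ^ 2) := by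
  simpa [HilbertBasis.repr_apply_apply] using hasSum_norm_sq_lp ((onb H).repr x)

theorem tsum_enorm_sq_inner_onb (x : H) : ∑' i, ‖⟪onb H i, x⟫_ℂ‖ₑ ^ 2 = ‖x‖ₑ ^ 2 := by
  have h := tsum_enorm_sq_lp ((onb H).repr x)
  simp only [HilbertBasis.repr_apply_apply] at h
  rw [h, enorm_eq_iff_norm_eq.2 ((onb H).repr.norm_map x)]

theorem summable_norm_inner_smul (a : HSSpace H) (f : H) :
    (Summable fun i => ‖⟪onb H i, f⟫_ℂ • a i‖) ∧
      ∑' i, ‖⟪onb H i, f⟫_ℂ • a i‖ ≤ ‖a‖ * ‖f‖ := by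
  have hf := hasSum_norm_sq_inner_onb f
  have ha := hasSum_norm_sq_lp a
  have h := Real.summable_and_inner_le_Lp_mul_Lq_tsum_of_nonneg Real.HolderConjugate.two_two
    (f := fun i => ‖a i‖) (g := fun i => ‖⟪onb H i, f⟫_ℂ‖)
    (fun i => norm_nonneg _) (fun i => norm_nonneg _)
    (by simpa using ha.summable) (by simpa using hf.summable)
  simp only [Real.rpow_two, hf.tsum_eq, ha.tsum_eq, ← Real.sqrt_eq_rpow,
    Real.sqrt_sq (norm_nonneg _)] at h
  simpa only [norm_smul, mul_comm] using h

theorem summable_inner_smul (a : HSSpace H) (f : H) :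
    Summable fun i => ⟪onb H i, f⟫_ℂ • a i :=
  (summable_norm_inner_smul a f).1.of_norm

/-- The Hilbert–Schmidt operator `f ↦ ∑ ⟨e_i, f⟩ a_i`. -/
def HSSpace.op (a : HSSpace H) : H →L[ℂ] H :=
  LinearMap.mkContinuous
    { toFun := fun f => ∑' i, ⟪onb H i, f⟫_ℂ • a i
      map_add' := fun f g => by
        simp_rw [inner_add_right, add_smul]
        exact (summable_inner_smul a f).tsum_add (summable_inner_smul a g)
      map_smul' := fun c f => by
        simp_rw [inner_smul_right, mul_smul]
        exact (summable_inner_smul a f).tsum_const_smul c }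
    ‖a‖ fun f => (norm_tsum_le_tsum_norm (summable_norm_inner_smul a f).1).trans
      (summable_norm_inner_smul a f).2

theorem HSSpace.hasSum_op (a : HSSpace H) (f : H) :
    HasSum (fun i => ⟪onb H i, f⟫_ℂ • a i) (a.op f) :=
  (summable_inner_smul a f).hasSum

theorem HSSpace.op_onb (a : HSSpace H) (i : basisIndex H) : a.op (onb H i) = a i := by
  refine (a.hasSum_op (onb H i)).unique ?_
  have := hasSum_single (f := fun j => ⟪onb H j, onb H i⟫_ℂ • a j) i fun j hj => by
    rw [(onb H).orthonormal.2 hj, zero_smul]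
  simpa [inner_self_eq_norm_sq_to_K, (onb H).orthonormal.1 i] using this

theorem ext_onb {A B : H →L[ℂ] H} (h : ∀ i, A (onb H i) = B (onb H i)) : A = B := by
  refine ContinuousLinearMap.ext_on (s := Set.range (onb H)) ?_ ?_
  · exact Submodule.dense_iff_topologicalClosure_eq_top.2 (onb H).dense_span
  · rintro _ ⟨i, rfl⟩
    exact h i

theorem HSSpace.isHilbertSchmidt_op (a : HSSpace H) : IsHilbertSchmidt a.op := by
  simpa [IsHilbertSchmidt, HSSpace.op_onb] using (hasSum_norm_sq_lp a).summable

theorem IsHilbertSchmidt.exists_op_eq {T : H →L[ℂ] H} (hT : IsHilbertSchmidt T) :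
    ∃ a : HSSpace H, a.op = T :=
  ⟨⟨fun i => T (onb H i), memℓp_gen (by simpa [IsHilbertSchmidt] using hT)⟩,
    ext_onb fun i => HSSpace.op_onb _ i⟩

theorem HSSpace.op_smul_add (c : ℂ) (a b : HSSpace H) : (c • a + b).op = c • a.op + b.op :=
  ext_onb fun i => by
    rw [add_apply, smul_apply, HSSpace.op_onb, HSSpace.op_onb, HSSpace.op_onb]
    rfl

/-- Composition `T ↦ A T` on Hilbert–Schmidt operators. -/
def HSSpace.compLeft (A : H →L[ℂ] H) : HSSpace H →L[ℂ] HSSpace H :=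
  lp.mapCLM 2 (fun _ => A) (norm_nonneg A) fun _ => le_rfl

theorem HSSpace.compLeft_apply (A : H →L[ℂ] H) (a : HSSpace H) (i : basisIndex H) :
    HSSpace.compLeft A a i = A (a i) := rfl

theorem HSSpace.op_compLeft (A : H →L[ℂ] H) (a : HSSpace H) :
    (HSSpace.compLeft A a).op = A ∘L a.op :=
  ext_onb fun i => by simp [HSSpace.op_onb, HSSpace.compLeft_apply]

/-- Expanding `b* e_i` in the basis gives a double series. Square summability makes it absolutely
summable, so the sums may be exchanged and Parseval applied. The order is reversed because the inner
product is antilinear in its first argument. -/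
theorem tr_op_comp_adjoint (a b : HSSpace H) : tr (a.op ∘L b.op.adjoint) = ⟪b, a⟫_ℂ := by
  have h1 : ∀ i, ⟪onb H i, (a.op ∘L b.op.adjoint) (onb H i)⟫_ℂ
      = ∑' j, ⟪b j, onb H i⟫_ℂ * ⟪onb H i, a j⟫_ℂ := fun i => by
    have := (a.hasSum_op (b.op.adjoint (onb H i))).mapL (innerSL ℂ (onb H i))
    simp only [innerSL_apply_apply, inner_smul_right, ContinuousLinearMap.adjoint_inner_right,
      HSSpace.op_onb] at this
    exact this.tsum_eq.symm
  have hs : Summable fun p : basisIndex H × basisIndex H =>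
      ⟪b p.1, onb H p.2⟫_ℂ * ⟪onb H p.2, a p.1⟫_ℂ := by
    have hsq : ∀ c : HSSpace H, Summable fun p : basisIndex H × basisIndex H =>
        ‖⟪onb H p.2, c p.1⟫_ℂ‖ ^ 2 := fun c => by
      refine (summable_prod_of_nonneg fun p => by positivity).2
        ⟨fun i => (hasSum_norm_sq_inner_onb (c i)).summable, ?_⟩
      simp_rw [(hasSum_norm_sq_inner_onb _).tsum_eq]
      exact (hasSum_norm_sq_lp c).summable
    refine Summable.of_norm_bounded ((hsq a).add (hsq b)) fun p => ?_
    rw [norm_mul, norm_inner_symm]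
    nlinarith [sq_nonneg (‖⟪onb H p.2, b p.1⟫_ℂ‖ - ‖⟪onb H p.2, a p.1⟫_ℂ‖),
      sq_nonneg (‖⟪onb H p.2, b p.1⟫_ℂ‖), sq_nonneg ‖⟪onb H p.2, a p.1⟫_ℂ‖]
  rw [tr]
  simp_rw [h1]
  rw [Summable.tsum_comm (f := fun j i => ⟪b j, onb H i⟫_ℂ * ⟪onb H i, a j⟫_ℂ) hs]
  simp_rw [HilbertBasis.tsum_inner_mul_inner]
  exact (lp.inner_eq_tsum b a).symm

/-- Distinct basis vectors are at distance `√2 ≥ 1`, so the balls of radius `1/2` around them are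
disjoint open sets. Countability is what permits measurability arguments and integration termwise in
the basis. -/
theorem countable_basisIndex [SecondCountableTopology H] : Countable (basisIndex H) := by
  have hd : Pairwise fun i j => 1 ≤ dist (onb H i) (onb H j) := fun i j hij => by
    have h := norm_sub_sq (𝕜 := ℂ) (onb H i) (onb H j)
    rw [(onb H).orthonormal.2 hij, (onb H).orthonormal.1, (onb H).orthonormal.1] at h
    change 1 ≤ dist (onb H i) (onb H j)
    rw [dist_eq_norm]
    norm_num at h
    nlinarith [norm_nonneg (onb H i - onb H j)]
  have hp : Set.PairwiseDisjoint Set.univ fun i => Metric.ball (onb H i) (1 / 2) :=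
    fun i _ j _ hij => Metric.ball_disjoint_ball (by linarith [hd hij])
  exact Set.countable_univ_iff.1 <| hp.countable_of_isOpen (fun i _ => Metric.isOpen_ball)
    fun i _ => ⟨onb H i, Metric.mem_ball_self (by norm_num)⟩

/-- The element `r` is the rank one operator `f ↦ ⟨v, f⟩ u`. -/
theorem exists_inner_eq_inner_op (u v : H) :
    ∃ r : HSSpace H, ∀ b : HSSpace H, ⟪r, b⟫_ℂ = ⟪u, b.op v⟫_ℂ := by
  have hr : IsHilbertSchmidt ((innerSL ℂ v).smulRight u : H →L[ℂ] H) := by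
    simp only [IsHilbertSchmidt, ContinuousLinearMap.smulRight_apply, innerSL_apply_apply,
      norm_smul, mul_pow]
    refine Summable.mul_right _ ?_
    simpa [norm_inner_symm] using (hasSum_norm_sq_inner_onb v).summable
  obtain ⟨r, hr⟩ := hr.exists_op_eq
  refine ⟨r, fun b => ?_⟩
  have h1 := (b.hasSum_op v).mapL (innerSL ℂ u)
  rw [lp.inner_eq_tsum, ← innerSL_apply_apply ℂ, ← h1.tsum_eq]
  refine tsum_congr fun i => ?_
  rw [← HSSpace.op_onb r, hr]
  simp [inner_smul_left]

end HilbertSchmidt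

/-! ### Moyal's identity for the operator short-time Fourier transform. -/

section OperatorSTFT

theorem measurable_of_hasSum {α ι : Type*} [MeasurableSpace α] [Countable ι] {f : ι → α → ℂ}
    {g : α → ℂ} (hf : ∀ i, Measurable (f i)) (h : ∀ x, HasSum (fun i => f i x) (g x)) :
    Measurable g :=
  measurable_of_tendsto_metrizable' atTop (fun s => Finset.measurable_fun_sum s fun i _ => hf i)
    (tendsto_pi_nhds.2 h)

variable {d : ℕ}

instance countable_basisIndex_L2 : Countable (basisIndex (L2 d)) :=
  haveI : Fact ((2 : ℝ≥0∞) ≠ ∞) := ⟨ENNReal.ofNat_ne_top⟩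
  countable_basisIndex

/-- The operator short-time Fourier transform at `z`, on Hilbert–Schmidt operators. -/
def hsSTFT (S : L2 d →L[ℂ] L2 d) (z : PhaseSpace d) : HSSpace (L2 d) →L[ℂ] HSSpace (L2 d) :=
  HSSpace.compLeft (S.adjoint ∘L (timeFreqShift z).adjoint)

variable (S : L2 d →L[ℂ] L2 d)

theorem op_hsSTFT (a : HSSpace (L2 d)) (z : PhaseSpace d) :
    (hsSTFT S z a).op = opSTFT S a.op z :=
  HSSpace.op_compLeft _ _

theorem trPair_opSTFT (a b : HSSpace (L2 d)) (z : PhaseSpace d) :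
    trPair (opSTFT S a.op) (opSTFT S b.op) z = ⟪hsSTFT S z b, hsSTFT S z a⟫_ℂ := by
  rw [trPair, ← op_hsSTFT, ← op_hsSTFT, tr_op_comp_adjoint]

theorem inner_onb_hsSTFT (a : HSSpace (L2 d)) (z : PhaseSpace d) (i j : basisIndex (L2 d)) :
    ⟪onb (L2 d) j, hsSTFT S z a i⟫_ℂ = ⟪timeFreqShift z (S (onb (L2 d) j)), a i⟫_ℂ := by
  simp [hsSTFT, HSSpace.compLeft_apply, ContinuousLinearMap.adjoint_inner_right]

theorem measurable_trPair (a b : HSSpace (L2 d)) :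
    Measurable (trPair (opSTFT S a.op) (opSTFT S b.op)) := by
  have hm : ∀ (c : HSSpace (L2 d)) i j,
      Measurable fun z : PhaseSpace d => ⟪onb (L2 d) j, hsSTFT S z c i⟫_ℂ := fun c i j => by
    simp_rw [inner_onb_hsSTFT]
    exact (stronglyMeasurable_inner_timeFreqShift _ _).measurable
  have h1 : ∀ i, Measurable fun z : PhaseSpace d => ⟪hsSTFT S z b i, hsSTFT S z a i⟫_ℂ :=
    fun i => measurable_of_hasSum (f := fun j z => ⟪hsSTFT S z b i, onb (L2 d) j⟫_ℂ *
      ⟪onb (L2 d) j, hsSTFT S z a i⟫_ℂ) (fun j => by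
        simp_rw [← inner_conj_symm (hsSTFT S _ b i)]
        exact (Complex.continuous_conj.measurable.comp (hm b i j)).mul (hm a i j))
      fun z => (onb (L2 d)).hasSum_inner_mul_inner _ _
  refine measurable_of_hasSum h1 fun z => ?_
  rw [trPair_opSTFT]
  exact lp.hasSum_inner _ _

theorem trPair_self (a : HSSpace (L2 d)) (z : PhaseSpace d) :
    trPair (opSTFT S a.op) (opSTFT S a.op) z = ((‖hsSTFT S z a‖ ^ 2 : ℝ) : ℂ) := by
  rw [trPair_opSTFT, inner_self_eq_norm_sq_to_K]
  norm_cast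

theorem measurable_norm_hsSTFT (a : HSSpace (L2 d)) :
    Measurable fun z : PhaseSpace d => ‖hsSTFT S z a‖ := by
  have h := (Complex.measurable_re.comp (measurable_trPair S a a)).sqrt
  refine (congrArg Measurable (funext fun z => ?_)).mpr h
  simp only [Function.comp_apply]
  rw [trPair_self, Complex.ofReal_re, Real.sqrt_sq (norm_nonneg _)]

theorem enorm_sq_hsSTFT (s a : HSSpace (L2 d)) (z : PhaseSpace d) :
    ‖hsSTFT s.op z a‖ₑ ^ 2 = ∑' i, ∑' j, ‖⟪timeFreqShift z (s j), a i⟫_ℂ‖ₑ ^ 2 := by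
  rw [← tsum_enorm_sq_lp]
  refine tsum_congr fun i => ?_
  rw [← tsum_enorm_sq_inner_onb]
  refine tsum_congr fun j => ?_
  rw [inner_onb_hsSTFT, HSSpace.op_onb]

/-- Moyal's identity for the operator short-time Fourier transform. -/
theorem lintegral_enorm_sq_hsSTFT (s a : HSSpace (L2 d)) :
    ∫⁻ z : PhaseSpace d, ‖hsSTFT s.op z a‖ₑ ^ 2 = ‖s‖ₑ ^ 2 * ‖a‖ₑ ^ 2 := by
  simp_rw [enorm_sq_hsSTFT]
  have hm : ∀ i j, Measurable fun z : PhaseSpace d => ‖⟪timeFreqShift z (s j), a i⟫_ℂ‖ₑ ^ 2 :=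
    fun i j => (stronglyMeasurable_inner_timeFreqShift _ _).measurable.enorm.pow_const 2
  rw [lintegral_tsum fun i => (Measurable.tsum fun j => hm i j).aemeasurable]
  calc _ = ∑' i, ∑' j, ‖s j‖ₑ ^ 2 * ‖a i‖ₑ ^ 2 := by
        refine tsum_congr fun i => ?_
        rw [lintegral_tsum fun j => (hm i j).aemeasurable]
        exact tsum_congr fun j => lintegral_enorm_sq_inner_timeFreqShift _ _
    _ = _ := by
        rw [← tsum_enorm_sq_lp s, ← tsum_enorm_sq_lp a, ← ENNReal.tsum_mul_left]
        exact tsum_congr fun i => ENNReal.tsum_mul_right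

/-- Cauchy–Schwarz twice, pointwise in the Hilbert–Schmidt space and then in `L²(dz)`, followed by
Moyal. -/
theorem lintegral_enorm_trPair_le (s a b : HSSpace (L2 d)) :
    ∫⁻ z, ‖trPair (opSTFT s.op a.op) (opSTFT s.op b.op) z‖ₑ ≤ ‖s‖ₑ ^ 2 * ‖a‖ₑ * ‖b‖ₑ := by
  have hm := fun c => (measurable_norm_hsSTFT s.op c).ennreal_ofReal
  simp_rw [ofReal_norm] at hm
  calc ∫⁻ z, ‖trPair (opSTFT s.op a.op) (opSTFT s.op b.op) z‖ₑ
      ≤ ∫⁻ z, ((fun z => ‖hsSTFT s.op z b‖ₑ) * fun z => ‖hsSTFT s.op z a‖ₑ) z := by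
        refine lintegral_mono fun z => ?_
        rw [trPair_opSTFT, Pi.mul_apply]
        simp_rw [← ofReal_norm]
        rw [← ENNReal.ofReal_mul (norm_nonneg _)]
        exact ENNReal.ofReal_le_ofReal (norm_inner_le_norm _ _)
    _ ≤ _ := ENNReal.lintegral_mul_le_Lp_mul_Lq _ Real.HolderConjugate.two_two
        (hm b).aemeasurable (hm a).aemeasurable
    _ = ‖s‖ₑ ^ 2 * ‖a‖ₑ * ‖b‖ₑ := by
        simp_rw [ENNReal.rpow_two, lintegral_enorm_sq_hsSTFT, ← mul_pow, ← ENNReal.rpow_two,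
          ← ENNReal.rpow_mul]
        norm_num
        ring

theorem integrable_trPair (s a b : HSSpace (L2 d)) :
    Integrable (trPair (opSTFT s.op a.op) (opSTFT s.op b.op)) := by
  refine ⟨(measurable_trPair _ _ _).aestronglyMeasurable,
    (lintegral_enorm_trPair_le s a b).trans_lt ?_⟩
  finiteness

theorem integral_norm_trPair_le (s a b : HSSpace (L2 d)) :
    ∫ z, ‖trPair (opSTFT s.op a.op) (opSTFT s.op b.op) z‖ ≤ ‖s‖ ^ 2 * ‖a‖ * ‖b‖ := by
  rw [integral_norm_eq_lintegral_enorm (integrable_trPair s a b).1]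
  refine ENNReal.toReal_le_of_le_ofReal (by positivity) ?_
  refine (lintegral_enorm_trPair_le s a b).trans_eq ?_
  rw [ENNReal.ofReal_mul (by positivity), ENNReal.ofReal_mul (by positivity),
    ENNReal.ofReal_pow (norm_nonneg _)]
  simp_rw [ofReal_norm]

theorem integral_norm_sq_hsSTFT (s a : HSSpace (L2 d)) :
    Integrable (fun z : PhaseSpace d => ((‖hsSTFT s.op z a‖ : ℂ)) ^ 2) ∧
      ∫ z : PhaseSpace d, (‖hsSTFT s.op z a‖ : ℂ) ^ 2 = (‖s‖ : ℂ) ^ 2 * (‖a‖ : ℂ) ^ 2 := by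
  have e : trPair (opSTFT s.op a.op) (opSTFT s.op a.op)
      = fun z : PhaseSpace d => (‖hsSTFT s.op z a‖ : ℂ) ^ 2 := by
    funext z
    rw [trPair_self, Complex.ofReal_pow]
  refine ⟨e ▸ integrable_trPair s a a, ?_⟩
  have h : ∫ z : PhaseSpace d, ‖hsSTFT s.op z a‖ ^ 2 = ‖s‖ ^ 2 * ‖a‖ ^ 2 := by
    rw [integral_eq_lintegral_of_nonneg_ae (Eventually.of_forall fun z => by positivity)
      ((measurable_norm_hsSTFT _ _).pow_const 2).aestronglyMeasurable]
    simp_rw [ENNReal.ofReal_pow (norm_nonneg _), ofReal_norm]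
    rw [lintegral_enorm_sq_hsSTFT]
    simp
  have h' := integral_ofReal (𝕜 := ℂ) (μ := volume)
    (f := fun z : PhaseSpace d => ‖hsSTFT s.op z a‖ ^ 2)
  rw [h] at h'
  simpa using h'

/-- `⟨𝔙_S A, 𝔙_S B⟩ = ‖S‖² ⟨A, B⟩`. -/
theorem gaborInner_opSTFT (s a b : HSSpace (L2 d)) :
    gaborInner (opSTFT s.op a.op) (opSTFT s.op b.op) = (‖s‖ : ℂ) ^ 2 * ⟪b, a⟫_ℂ := by
  let f : HSSpace (L2 d) → PhaseSpace d → ℂ := fun c z => (‖hsSTFT s.op z c‖ : ℂ) ^ 2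
  have I : ∀ c, Integrable (f c) := fun c => (integral_norm_sq_hsSTFT s c).1
  have J : ∀ c, ∫ z, f c z = (‖s‖ : ℂ) ^ 2 * (‖c‖ : ℂ) ^ 2 :=
    fun c => (integral_norm_sq_hsSTFT s c).2
  have K : ∀ c c', Integrable fun z => f c z - f c' z := fun c c' => (I c).sub (I c')
  -- Polarization reduces the sesquilinear identity to the norm identity.
  have pol : ∀ z, trPair (opSTFT s.op a.op) (opSTFT s.op b.op) z
      = (f (b + a) z - f (b - a) z
        + (f (b - Complex.I • a) z - f (b + Complex.I • a) z) * Complex.I) / 4 := fun z => by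
    rw [trPair_opSTFT, inner_eq_sum_norm_sq_div_four]
    simp only [f, map_add, map_sub, map_smul]
    rfl
  calc gaborInner (opSTFT s.op a.op) (opSTFT s.op b.op)
      = ∫ z, (f (b + a) z - f (b - a) z
        + (f (b - Complex.I • a) z - f (b + Complex.I • a) z) * Complex.I) / 4 :=
        integral_congr_ae (Eventually.of_forall pol)
    _ = ((∫ z, f (b + a) z) - (∫ z, f (b - a) z)
        + ((∫ z, f (b - Complex.I • a) z) - ∫ z, f (b + Complex.I • a) z) * Complex.I) / 4 := by
        rw [integral_div, integral_add (K _ _) ((K _ _).mul_const _),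
          integral_mul_const, integral_sub (I _) (I _), integral_sub (I _) (I _)]
    _ = _ := by
        rw [J, J, J, J, inner_eq_sum_norm_sq_div_four b a]
        simp only [RCLike.I_to_complex, RCLike.ofReal_eq_complex_ofReal]
        ring

end OperatorSTFT

/-! ### Schwartz functions in Feichtinger's algebra, and bounds for `F * χ_N`. -/

section Schwartz

variable {ι : Type} [Fintype ι]

theorem exists_pow_mul_exp_neg_sq_le (m : ℕ) :
    ∃ C : ℝ, ∀ r : ℝ, 0 ≤ r → (1 + r) ^ m * Real.exp (-Real.pi * r ^ 2) ≤ C := by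
  -- From `x^m ≤ m! e^x` at `x = 1 + r`, and `1 + r - π r² ≤ 2`.
  refine ⟨m.factorial * Real.exp 2, fun r hr => ?_⟩
  have h1 := Real.pow_div_factorial_le_exp (1 + r) (by positivity) m
  rw [div_le_iff₀ (by positivity)] at h1
  calc (1 + r) ^ m * Real.exp (-Real.pi * r ^ 2)
      ≤ Real.exp (1 + r) * m.factorial * Real.exp (-Real.pi * r ^ 2) := by gcongr
    _ = m.factorial * Real.exp (1 + r - Real.pi * r ^ 2) := by
        rw [mul_right_comm, ← Real.exp_add, mul_comm]
        ring_nf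
    _ ≤ _ := by
        gcongr
        nlinarith [Real.pi_gt_three, sq_nonneg (r - 1), sq_nonneg r]

theorem gaussian_decay (k n : ℕ) : ∃ C : ℝ, ∀ t : EuclideanSpace ℝ ι,
    ‖t‖ ^ k * ‖iteratedFDeriv ℝ n
      (fun t : EuclideanSpace ℝ ι => Real.exp (-Real.pi * ‖t‖ ^ 2)) t‖ ≤ C := by
  have hq : (fun t : EuclideanSpace ℝ ι => -Real.pi * ‖t‖ ^ 2).HasTemperateGrowth := by fun_prop
  obtain ⟨m, A, hA, hmA⟩ := hq.norm_iteratedFDeriv_le_uniform n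
  obtain ⟨C, hC⟩ := exists_pow_mul_exp_neg_sq_le (k + m * n)
  refine ⟨n.factorial * (1 + A) ^ n * C, fun t => ?_⟩
  have h1 : (1 : ℝ) ≤ 1 + ‖t‖ := by simp
  have h := norm_iteratedFDeriv_comp_le (𝕜 := ℝ) (g := Real.exp) (n := n)
    (N := n) Real.contDiff_exp (hq.1.of_le (by exact_mod_cast le_top)) le_rfl t
    (C := Real.exp (-Real.pi * ‖t‖ ^ 2)) (D := (1 + A) * (1 + ‖t‖) ^ m)
    (fun i _ => by
      rw [norm_iteratedFDeriv_eq_norm_iteratedDeriv, iteratedDeriv_eq_iterate,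
        Real.iter_deriv_exp, Real.norm_eq_abs, Real.abs_exp])
    (fun i hi hin => by
      -- The composition bound asks for the `i`-th power of this quantity; as it is at least `1` and
      -- `i ≥ 1`, the first power is enough.
      have hb : 1 ≤ (1 + A) * (1 + ‖t‖) ^ m :=
        one_le_mul_of_one_le_of_one_le (by linarith) (one_le_pow₀ h1)
      refine (hmA i hin t).trans (le_trans ?_ (le_self_pow₀ hb (by omega)))
      gcongr
      linarith)
  calc _ ≤ (1 + ‖t‖) ^ k * (n.factorial * Real.exp (-Real.pi * ‖t‖ ^ 2) *
        ((1 + A) * (1 + ‖t‖) ^ m) ^ n) := by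
        refine mul_le_mul ?_ h (norm_nonneg _) (by positivity)
        gcongr
        linarith
    _ = n.factorial * (1 + A) ^ n *
        ((1 + ‖t‖) ^ (k + m * n) * Real.exp (-Real.pi * ‖t‖ ^ 2)) := by
        rw [mul_pow, ← pow_mul, pow_add]
        ring
    _ ≤ _ := by
        gcongr
        exact hC _ (norm_nonneg t)

theorem exists_schwartz_eq_gaussian : ∃ g : 𝓢(EuclideanSpace ℝ ι, ℂ), ∀ t, g t = gaussian t := by
  let g₀ : 𝓢(EuclideanSpace ℝ ι, ℝ) :=
    { toFun := fun t => Real.exp (-Real.pi * ‖t‖ ^ 2)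
      smooth' := (contDiff_const.mul (contDiff_norm_sq ℝ)).exp
      decay' := gaussian_decay }
  refine ⟨((2 : ℝ) ^ ((Fintype.card ι : ℝ) / 4)) •
    SchwartzMap.postcompCLM (𝕜 := ℝ) Complex.ofRealCLM g₀, fun t => ?_⟩
  have h : g₀ t = Real.exp (-Real.pi * ‖t‖ ^ 2) := rfl
  rw [smul_apply, SchwartzMap.postcompCLM_apply, h, gaussian, Complex.ofReal_mul]
  rfl

/-- The Schwartz function `t ↦ f(t) conj(g(t - x))`. -/
def windowed (f g : 𝓢(EuclideanSpace ℝ ι, ℂ)) (x : EuclideanSpace ℝ ι) :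
    𝓢(EuclideanSpace ℝ ι, ℂ) :=
  SchwartzMap.smulLeftCLM ℂ
    (SchwartzMap.compSubConstCLM ℝ x
      (SchwartzMap.postcompCLM (𝕜 := ℝ) (Complex.conjCLE : ℂ →L[ℝ] ℂ) g)) f

theorem windowed_apply (f g : 𝓢(EuclideanSpace ℝ ι, ℂ)) (x t : EuclideanSpace ℝ ι) :
    windowed f g x t = f t * conj (g (t - x)) := by
  rw [windowed, SchwartzMap.smulLeftCLM_apply_apply (SchwartzMap.hasTemperateGrowth _)]
  simp [mul_comm]

theorem exists_one_add_norm_pow_mul_iteratedFDeriv_le {F : Type*} [NormedAddCommGroup F]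
    [NormedSpace ℝ F] (f : 𝓢(EuclideanSpace ℝ ι, F)) (k n : ℕ) :
    ∃ C : ℝ, 0 ≤ C ∧ ∀ i ≤ n, ∀ t, (1 + ‖t‖) ^ k * ‖iteratedFDeriv ℝ i f t‖ ≤ C :=
  ⟨_, by positivity, fun _ hi t =>
    SchwartzMap.one_add_le_sup_seminorm_apply (𝕜 := ℝ) (m := (k, n)) le_rfl hi f t⟩

/-- Leibniz' rule, with the weight in `x` split by `1 + ‖x‖ ≤ (1 + ‖t - x‖)(1 + ‖t‖)`: one factor is
absorbed by the window and the other by `f`. -/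
theorem exists_seminorm_windowed_le (f g : 𝓢(EuclideanSpace ℝ ι, ℂ)) (N k l : ℕ) :
    ∃ C : ℝ, ∀ x, (1 + ‖x‖) ^ N * SchwartzMap.seminorm ℂ k l (windowed f g x) ≤ C := by
  let G := SchwartzMap.postcompCLM (𝕜 := ℝ) (Complex.conjCLE : ℂ →L[ℝ] ℂ) g
  obtain ⟨A, hA0, hA⟩ := exists_one_add_norm_pow_mul_iteratedFDeriv_le G N l
  obtain ⟨B, hB0, hB⟩ := exists_one_add_norm_pow_mul_iteratedFDeriv_le f (N + k) l
  refine ⟨∑ i ∈ Finset.range (l + 1), (l.choose i : ℝ) * (A * B), fun x => ?_⟩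
  rw [← le_div_iff₀' (by positivity)]
  refine SchwartzMap.seminorm_le_bound ℂ k l _ (by positivity) fun t => ?_
  rw [le_div_iff₀' (by positivity)]
  have e : (windowed f g x : EuclideanSpace ℝ ι → ℂ) = fun t => G (t - x) * f t := by
    funext t
    rw [windowed_apply, mul_comm]
    rfl
  have h := norm_iteratedFDeriv_mul_le (𝕜 := ℝ) (f := fun t => G (t - x)) (g := f) (N := l)
    ((G.smooth l).comp (contDiff_id.sub contDiff_const)) (f.smooth l) t le_rfl
  have hx : 1 + ‖x‖ ≤ (1 + ‖t - x‖) * (1 + ‖t‖) := by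
    have : ‖x‖ ≤ ‖t‖ + ‖t - x‖ := by simpa using norm_sub_le t (t - x)
    nlinarith [norm_nonneg t, norm_nonneg (t - x)]
  rw [e]
  calc _ ≤ ((1 + ‖t - x‖) * (1 + ‖t‖)) ^ N * ((1 + ‖t‖) ^ k *
        ∑ i ∈ Finset.range (l + 1), (l.choose i : ℝ) *
          ‖iteratedFDeriv ℝ i (fun t => G (t - x)) t‖ * ‖iteratedFDeriv ℝ (l - i) f t‖) := by
        gcongr
        linarith
    _ = ∑ i ∈ Finset.range (l + 1), (l.choose i : ℝ) *
          (((1 + ‖t - x‖) ^ N * ‖iteratedFDeriv ℝ i (fun t => G (t - x)) t‖) *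
          ((1 + ‖t‖) ^ (N + k) * ‖iteratedFDeriv ℝ (l - i) f t‖)) := by
        rw [Finset.mul_sum, Finset.mul_sum]
        refine Finset.sum_congr rfl fun i _ => ?_
        rw [mul_pow, pow_add]
        ring
    _ ≤ _ := by
        refine Finset.sum_le_sum fun i hi => ?_
        rw [iteratedFDeriv_comp_sub]
        have hi' : i ≤ l := Nat.lt_succ_iff.1 (Finset.mem_range.1 hi)
        exact mul_le_mul_of_nonneg_left (mul_le_mul (hA i hi' _) (hB _ (Nat.sub_le _ _) t)
          (by positivity) hA0) (by positivity)

-- Continuity of the Fourier transform on Schwartz space gives decay in `ω` in terms of finitely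
-- many seminorms of the windowed function, and each of these decays rapidly in `x`.
open FourierTransform in
theorem exists_norm_fourier_windowed_le (f g : 𝓢(EuclideanSpace ℝ ι, ℂ)) (N : ℕ) :
    ∃ C : ℝ, 0 ≤ C ∧ ∀ x ω,
      (1 + ‖x‖) ^ N * ((1 + ‖ω‖) ^ N * ‖𝓕 (windowed f g x) ω‖) ≤ C := by
  let q : Seminorm ℂ 𝓢(EuclideanSpace ℝ ι, ℂ) := (Finset.Iic (N, 0)).sup
    fun m => SchwartzMap.seminorm ℂ m.1 m.2
  have hq : Continuous q := by
    refine Seminorm.continuous_of_le (q := ∑ m ∈ Finset.Iic (N, 0),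
      SchwartzMap.seminorm ℂ m.1 m.2) ?_ (Seminorm.finset_sup_le_sum _ _)
    have : ⇑(∑ m ∈ Finset.Iic (N, 0),
        SchwartzMap.seminorm (E := EuclideanSpace ℝ ι) (F := ℂ) ℂ m.1 m.2)
        = fun f => ∑ m ∈ Finset.Iic (N, 0), SchwartzMap.seminorm ℂ m.1 m.2 f := by
      funext f
      simp
    rw [this]
    exact continuous_finsetSum _ fun m _ =>
      (schwartz_withSeminorms ℂ (EuclideanSpace ℝ ι) ℂ).continuous_seminorm m
  obtain ⟨s, c, -, hc⟩ := Seminorm.bound_of_continuous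
    (schwartz_withSeminorms ℂ (EuclideanSpace ℝ ι) ℂ)
    (q.comp (fourierCLM ℂ 𝓢(EuclideanSpace ℝ ι, ℂ)).toLinearMap)
    (hq.comp (fourierCLM ℂ 𝓢(EuclideanSpace ℝ ι, ℂ)).continuous)
  choose A hA using fun m : ℕ × ℕ => exists_seminorm_windowed_le f g N m.1 m.2
  have key : ∀ x ω, (1 + ‖x‖) ^ N * ((1 + ‖ω‖) ^ N * ‖𝓕 (windowed f g x) ω‖)
      ≤ 2 ^ N * (c * ∑ m ∈ s, A m) := fun x ω => by
    have h1 : (1 + ‖ω‖) ^ N * ‖𝓕 (windowed f g x) ω‖ ≤ 2 ^ N * q (𝓕 (windowed f g x)) := by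
      simpa using SchwartzMap.one_add_le_sup_seminorm_apply (𝕜 := ℂ) (m := (N, 0)) le_rfl le_rfl
        (𝓕 (windowed f g x)) ω
    have h2 : q (𝓕 (windowed f g x)) ≤ c * ∑ m ∈ s,
        SchwartzMap.seminorm ℂ m.1 m.2 (windowed f g x) := by
      refine (hc (windowed f g x)).trans ?_
      have h := Seminorm.finset_sup_le_sum (schwartzSeminormFamily ℂ (EuclideanSpace ℝ ι) ℂ) s
        (windowed f g x)
      refine mul_le_mul_of_nonneg_left (h.trans_eq ?_) c.2
      simp
      rfl
    calc _ ≤ (1 + ‖x‖) ^ N * (2 ^ N * (c * ∑ m ∈ s,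
          SchwartzMap.seminorm ℂ m.1 m.2 (windowed f g x))) := by
          exact mul_le_mul_of_nonneg_left
            (h1.trans (mul_le_mul_of_nonneg_left h2 (by positivity))) (by positivity)
      _ = 2 ^ N * (c * ∑ m ∈ s, (1 + ‖x‖) ^ N *
          SchwartzMap.seminorm ℂ m.1 m.2 (windowed f g x)) := by
          rw [← Finset.mul_sum]
          ring
      _ ≤ _ := by
          gcongr with m
          exact hA m x
  exact ⟨_, le_trans (by positivity) (key 0 0), key⟩

open FourierTransform in
theorem stft_eq_fourier_windowed {f g : 𝓢(EuclideanSpace ℝ ι, ℂ)} {g' : EuclideanSpace ℝ ι → ℂ}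
    (hg : ∀ t, g t = g' t) (x ω : EuclideanSpace ℝ ι) :
    stft g' f x ω = 𝓕 (windowed f g x) ω := by
  rw [stft, SchwartzMap.fourier_coe, Real.fourier_eq']
  refine integral_congr_ae (Eventually.of_forall fun t => ?_)
  simp only [windowed_apply, hg, character, smul_eq_mul, real_inner_comm]
  rw [mul_comm, mul_comm Complex.I]
  norm_num

/-- Schwartz functions belong to Feichtinger's algebra. -/
theorem feichtingerNorm_lt_top (f : 𝓢(EuclideanSpace ℝ ι, ℂ)) : feichtingerNorm f < ∞ := by
  obtain ⟨g, hg⟩ := exists_schwartz_eq_gaussian (ι := ι)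
  -- One more than the dimension, so that `(1 + ‖x‖)^(-N)` is integrable.
  set N := Fintype.card ι + 1
  obtain ⟨C, hC0, hC⟩ := exists_norm_fourier_windowed_le f g N
  let w : EuclideanSpace ℝ ι → ℝ≥0∞ := fun x => ENNReal.ofReal ((1 + ‖x‖) ^ (-(N : ℝ)))
  have hw : ∫⁻ x, w x < ∞ := finite_integral_one_add_norm (by simp [N])
  have hle : ∀ x ω, ‖stft gaussian f x ω‖ₑ ≤ ENNReal.ofReal C * w x * w ω := fun x ω => by
    rw [stft_eq_fourier_windowed hg, ← ofReal_norm, ← ENNReal.ofReal_mul hC0,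
      ← ENNReal.ofReal_mul (by positivity)]
    refine ENNReal.ofReal_le_ofReal ?_
    rw [Real.rpow_neg (by positivity), Real.rpow_neg (by positivity), Real.rpow_natCast,
      Real.rpow_natCast, ← div_eq_mul_inv, ← div_eq_mul_inv, le_div_iff₀ (by positivity),
      le_div_iff₀ (by positivity)]
    linarith [hC x ω]
  calc feichtingerNorm f ≤ ∫⁻ x, ∫⁻ ω, ENNReal.ofReal C * w x * w ω :=
        lintegral_mono fun x => lintegral_mono fun ω => hle x ω
    _ = ENNReal.ofReal C * (∫⁻ x, w x) * ∫⁻ ω, w ω := by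
        rw [lintegral_congr fun x => lintegral_const_mul' (ENNReal.ofReal C * w x) w
          (ENNReal.mul_ne_top ENNReal.ofReal_ne_top ENNReal.ofReal_ne_top),
          lintegral_mul_const' _ _ hw.ne, lintegral_const_mul' _ _ ENNReal.ofReal_ne_top]
    _ < ∞ := ENNReal.mul_lt_top (ENNReal.mul_lt_top ENNReal.ofReal_lt_top hw) hw

theorem enorm_character (ω t : EuclideanSpace ℝ ι) : ‖character ω t‖ₑ = 1 := by
  rw [← ofReal_norm, character, mul_comm, Complex.norm_exp_ofReal_mul_I, ENNReal.ofReal_one]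

theorem enorm_stft_comp_sub (g f : EuclideanSpace ℝ ι → ℂ) (z x ω : EuclideanSpace ℝ ι) :
    ‖stft g (fun t => f (t - z)) x ω‖ₑ = ‖stft g f (x - z) ω‖ₑ := by
  have h : stft g (fun t => f (t - z)) x ω = stft g f (x - z) ω * character ω z := by
    rw [stft, stft, ← integral_sub_right_eq_self
      (fun t => f t * conj (g (t - (x - z))) * character ω t) z, ← integral_mul_const]
    refine integral_congr_ae (Eventually.of_forall fun t => ?_)
    have : character ω t = character ω (t - z) * character ω z := by
      rw [character, character, character, ← Complex.exp_add, inner_sub_right]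
      congr 1
      push_cast
      ring
    simp only [this, sub_sub_sub_cancel_right]
    ring
  rw [h, enorm_mul, enorm_character, mul_one]

theorem feichtingerNorm_comp_sub (f : EuclideanSpace ℝ ι → ℂ) (z : EuclideanSpace ℝ ι) :
    feichtingerNorm (fun t => f (t - z)) = feichtingerNorm f := by
  simp_rw [feichtingerNorm, enorm_stft_comp_sub]
  exact lintegral_sub_right_eq_self (fun x => ∫⁻ ω, ‖stft gaussian f x ω‖ₑ) z

theorem mollifierAt_eq_compSubConst (χ : 𝓢(EuclideanSpace ℝ ι, ℂ)) (k : ℕ)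
    (z : EuclideanSpace ℝ ι) :
    mollifierAt χ k z = SchwartzMap.compSubConstCLM ℂ z (mollifierAt χ k 0) := by
  ext t
  simp [mollifierAt_apply]

/-- The functions `mollifierAt χ k z` are translates of one another in `z`, and the Feichtinger norm
is translation invariant. The bound depends on `k`. -/
theorem exists_norm_regularization_le {F : 𝓢'(EuclideanSpace ℝ ι, ℂ)} (hF : IsMild F)
    (χ : 𝓢(EuclideanSpace ℝ ι, ℂ)) (k : ℕ) : ∃ M : ℝ, ∀ z, ‖regularization F χ k z‖ ≤ M := by
  obtain ⟨C, hC⟩ := hF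
  have hfin : C * feichtingerNorm (mollifierAt χ k 0) < ∞ :=
    ENNReal.mul_lt_top ENNReal.coe_lt_top (feichtingerNorm_lt_top _)
  refine ⟨(C * feichtingerNorm (mollifierAt χ k 0)).toReal, fun z => ?_⟩
  have h := hC (mollifierAt χ k z)
  rw [mollifierAt_eq_compSubConst] at h
  change _ ≤ C * feichtingerNorm (fun t => mollifierAt χ k 0 (t - z)) at h
  rw [feichtingerNorm_comp_sub, ← mollifierAt_eq_compSubConst, ← ofReal_norm] at h
  exact (ENNReal.ofReal_le_iff_le_toReal hfin.ne).1 h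

theorem tendsto_compSubConst (f : 𝓢(EuclideanSpace ℝ ι, ℂ)) :
    Tendsto (fun h => SchwartzMap.compSubConstCLM ℂ h f) (𝓝 0) (𝓝 f) := by
  rw [(schwartz_withSeminorms ℂ (EuclideanSpace ℝ ι) ℂ).tendsto_nhds]
  rintro ⟨k, l⟩ ε hε
  obtain ⟨C, hC0, hC⟩ := exists_one_add_norm_pow_mul_iteratedFDeriv_le f k (l + 1)
  have hbound : ∀ h : EuclideanSpace ℝ ι, ‖h‖ < 1 →
      SchwartzMap.seminorm ℂ k l (SchwartzMap.compSubConstCLM ℂ h f - f) ≤ C * ‖h‖ := fun h hh => by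
    refine SchwartzMap.seminorm_le_bound ℂ k l _ (by positivity) fun t => ?_
    have e : iteratedFDeriv ℝ l (SchwartzMap.compSubConstCLM ℂ h f - f : 𝓢(_, ℂ)) t
        = iteratedFDeriv ℝ l f (t - h) - iteratedFDeriv ℝ l f t := by
      have h1 : ContDiffAt ℝ l (fun t => f (t - h)) t :=
        ((f.smooth l).comp (contDiff_id.sub contDiff_const)).contDiffAt
      have := iteratedFDeriv_sub_apply h1 (f.smooth l).contDiffAt
      rw [iteratedFDeriv_comp_sub] at this
      exact this
    have hd : Differentiable ℝ (iteratedFDeriv ℝ l f) :=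
      (f.smooth ⊤).differentiable_iteratedFDeriv (by exact_mod_cast ENat.natCast_lt_top l)
    -- Mean value inequality on the unit ball around `t`. The weight is frozen at `‖t‖ ^ k`, and
    -- `‖t‖ ≤ 1 + ‖s‖` there.
    have hmv := Convex.norm_image_sub_le_of_norm_fderiv_le (𝕜 := ℝ)
      (f := fun s => ‖t‖ ^ k • iteratedFDeriv ℝ l f s) (C := C) (s := Metric.closedBall t 1)
      (x := t) (y := t - h) (fun s _ => (hd s).fun_const_smul _) (fun s hs => by
        rw [fderiv_fun_const_smul (hd s), norm_smul, norm_pow, norm_norm,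
          norm_fderiv_iteratedFDeriv]
        refine le_trans ?_ (hC (l + 1) le_rfl s)
        gcongr
        have h1 := norm_sub_norm_le t s
        rw [norm_sub_rev, ← dist_eq_norm] at h1
        linarith [Metric.mem_closedBall.1 hs])
      (convex_closedBall t 1) (Metric.mem_closedBall_self zero_le_one)
      (by simpa [dist_eq_norm] using hh.le)
    rw [← smul_sub, norm_smul, norm_pow, norm_norm] at hmv
    rw [e]
    simpa using hmv
  have hlim : Tendsto (fun h : EuclideanSpace ℝ ι => C * ‖h‖) (𝓝 0) (𝓝 0) := by
    have : Continuous fun h : EuclideanSpace ℝ ι => C * ‖h‖ := by fun_prop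
    simpa using this.tendsto 0
  filter_upwards [hlim.eventually_lt_const hε, Metric.ball_mem_nhds 0 one_pos] with h h1 h2
  exact (hbound h (by simpa using h2)).trans_lt h1

theorem continuous_regularization (F : 𝓢'(EuclideanSpace ℝ ι, ℂ))
    (χ : 𝓢(EuclideanSpace ℝ ι, ℂ)) (k : ℕ) : Continuous (regularization F χ k) := by
  refine continuous_iff_continuousAt.2 fun z => ?_
  have h1 : Tendsto (fun y : EuclideanSpace ℝ ι => y - z) (𝓝 z) (𝓝 0) := by
    have : Continuous fun y : EuclideanSpace ℝ ι => y - z := by fun_prop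
    simpa using this.tendsto z
  have h2 := ((F.cont.tendsto _).comp (tendsto_compSubConst (mollifierAt χ k z))).comp h1
  refine h2.congr fun y => ?_
  simp only [Function.comp_apply, regularization]
  have e : SchwartzMap.compSubConstCLM ℂ (y - z) (mollifierAt χ k z) = mollifierAt χ k y := by
    ext t
    simp only [SchwartzMap.compSubConstCLM_apply, mollifierAt_apply]
    congr 3
    abel
  rw [e]
  rfl

/-- The dilation factor cancels the Jacobian, so for bounded `F` the regularizations are bounded
uniformly in `k`. -/
theorem integral_norm_mollifierAt (χ : 𝓢(EuclideanSpace ℝ ι, ℂ)) (k : ℕ)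
    (z : EuclideanSpace ℝ ι) : ∫ t, ‖mollifierAt χ k z t‖ = ∫ t, ‖χ t‖ := by
  have hk : (0 : ℝ) < (k : ℝ) + 1 := by positivity
  simp_rw [mollifierAt_apply, norm_mul]
  rw [integral_const_mul,
    integral_sub_left_eq_self (fun t => ‖χ (((k : ℝ) + 1) • t)‖) volume z,
    Measure.integral_comp_smul volume (fun t => ‖χ t‖), finrank_euclideanSpace, smul_eq_mul,
    abs_of_pos (by positivity), ← mul_assoc, norm_pow]
  have : ‖(k : ℂ) + 1‖ = (k : ℝ) + 1 := by
    rw [← Complex.ofReal_natCast, ← Complex.ofReal_one, ← Complex.ofReal_add, Complex.norm_real,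
      Real.norm_of_nonneg hk.le]
  rw [this, mul_inv_cancel₀ (by positivity), one_mul]

theorem IsBoundedFunction.exists_norm_regularization_le {F : 𝓢'(EuclideanSpace ℝ ι, ℂ)}
    (hF : IsBoundedFunction F) (χ : 𝓢(EuclideanSpace ℝ ι, ℂ)) :
    ∃ M : ℝ, ∀ k z, ‖regularization F χ k z‖ ≤ M := by
  obtain ⟨f, hf, hFf⟩ := hF
  refine ⟨(eLpNorm f ∞).toReal * ∫ t, ‖χ t‖, fun k z => ?_⟩
  rw [regularization, hFf, ← integral_norm_mollifierAt χ k z, ← integral_const_mul]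
  refine norm_integral_le_of_norm_le ((mollifierAt χ k z).integrable.norm.const_mul _) ?_
  filter_upwards [ae_le_eLpNormEssSup (f := f) (μ := volume)] with t ht
  rw [norm_mul]
  gcongr
  rw [eLpNorm_exponent_top, ← toReal_enorm]
  exact ENNReal.toReal_mono (by simpa using hf.2.ne) ht

theorem exists_schwartz_integral_eq_one :
    ∃ χ : 𝓢(EuclideanSpace ℝ ι, ℂ), ∫ t, χ t = 1 := by
  let b : ContDiffBump (0 : EuclideanSpace ℝ ι) := default
  have hc : HasCompactSupport fun t => (b.normed volume t : ℂ) :=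
    b.hasCompactSupport_normed.comp_left Complex.ofReal_zero
  refine ⟨hc.toSchwartzMap (Complex.ofRealCLM.contDiff.comp b.contDiff_normed), ?_⟩
  have := integral_ofReal (𝕜 := ℂ) (μ := volume) (f := b.normed volume)
  rw [b.integral_normed] at this
  exact this.trans Complex.ofReal_one

end Schwartz

/-! ### Convergence from a dense span, and uniqueness of the distributional integral. -/

section Convergence

theorem tendsto_of_dense_span {E : Type*} [NormedAddCommGroup E] [NormedSpace ℂ E]
    {L : ℕ → E →L⋆[ℂ] ℂ} {l : E →L⋆[ℂ] ℂ} {C : ℝ} (hC : ∀ k, ‖L k‖ ≤ C) {D : Set E}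
    (hD : Dense (Submodule.span ℂ D : Set E))
    (h : ∀ b ∈ D, Tendsto (fun k => L k b) atTop (𝓝 (l b))) (b : E) :
    Tendsto (fun k => L k b) atTop (𝓝 (l b)) := by
  have hspan : ∀ b ∈ Submodule.span ℂ D, Tendsto (fun k => L k b) atTop (𝓝 (l b)) := by
    intro b hb
    induction hb using Submodule.span_induction with
    | mem x hx => exact h x hx
    | zero => simp
    | add x y _ _ hx hy => simpa using hx.add hy
    | smul c x _ hx => simpa using hx.const_mul (conj c)
  have hC0 : 0 ≤ C := (norm_nonneg _).trans (hC 0)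
  rw [Metric.tendsto_atTop]
  intro ε hε
  -- With this radius the errors of `L k` and of `l` together stay below `ε / 2`; the `+ 1` keeps
  -- the denominator positive.
  obtain ⟨b', hb', hbb'⟩ := Metric.dense_iff.1 hD b (ε / (2 * (C + ‖l‖ + 1))) (by positivity)
  rw [Metric.mem_ball, dist_eq_norm, lt_div_iff₀ (by positivity)] at hb'
  obtain ⟨K, hK⟩ := Metric.tendsto_atTop.1 (hspan b' hbb') (ε / 2) (by positivity)
  refine ⟨K, fun k hk => ?_⟩
  have h1 := hK k hk
  rw [dist_eq_norm] at h1 ⊢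
  have h2 : ‖L k (b' - b)‖ ≤ C * ‖b' - b‖ := (L k).le_of_opNorm_le (hC k) _
  have h3 : ‖l (b' - b)‖ ≤ ‖l‖ * ‖b' - b‖ := l.le_opNorm _
  have e : L k b - l b = (L k b' - l b') - L k (b' - b) + l (b' - b) := by
    rw [map_sub, map_sub]
    ring
  rw [e]
  have h4 := norm_add_le (L k b' - l b' - L k (b' - b)) (l (b' - b))
  have h5 := norm_sub_le (L k b' - l b') (L k (b' - b))
  nlinarith [norm_nonneg (b' - b)]

variable {ι : Type} [Fintype ι]

theorem HasDistribIntegral.const_mul {F : 𝓢'(EuclideanSpace ℝ ι, ℂ)}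
    {h : EuclideanSpace ℝ ι → ℂ} {c : ℂ} (hF : HasDistribIntegral F h c) (κ : ℂ) :
    HasDistribIntegral F (fun z => κ * h z) (κ * c) := by
  refine ⟨hF.1.const_mul κ, fun χ hχ => ((hF.2 χ hχ).const_mul κ).congr fun k => ?_⟩
  rw [← integral_const_mul]
  refine integral_congr_ae (Eventually.of_forall fun z => ?_)
  simp only
  ring

/-- The definition quantifies over all `χ` with integral `1`; the existence of one such `χ` makes
the limit unique. -/
theorem HasDistribIntegral.unique {F : 𝓢'(EuclideanSpace ℝ ι, ℂ)}
    {h : EuclideanSpace ℝ ι → ℂ} {c c' : ℂ} (hc : HasDistribIntegral F h c)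
    (hc' : HasDistribIntegral F h c') : c = c' := by
  obtain ⟨χ, hχ⟩ := exists_schwartz_integral_eq_one (ι := ι)
  exact tendsto_nhds_unique (hc.2 χ hχ) (hc'.2 χ hχ)

end Convergence

/-! ### Toeplitz forms and the weak eigenvalue equation. -/

section Toeplitz

variable {d : ℕ}

theorem norm_integral_mul_trPair_le (s a b : HSSpace (L2 d)) {u : PhaseSpace d → ℂ} {M : ℝ}
    (hM : ∀ z, ‖u z‖ ≤ M) :
    ‖∫ z, u z * trPair (opSTFT s.op a.op) (opSTFT s.op b.op) z‖ ≤ M * ‖s‖ ^ 2 * ‖a‖ * ‖b‖ := by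
  have hM0 : 0 ≤ M := (norm_nonneg _).trans (hM 0)
  calc _ ≤ ∫ z, M * ‖trPair (opSTFT s.op a.op) (opSTFT s.op b.op) z‖ := by
        refine norm_integral_le_of_norm_le ((integrable_trPair s a b).norm.const_mul M)
          (Eventually.of_forall fun z => ?_)
        rw [norm_mul]
        exact mul_le_mul_of_nonneg_right (hM z) (norm_nonneg _)
    _ ≤ M * (‖s‖ ^ 2 * ‖a‖ * ‖b‖) := by
        rw [integral_const_mul]
        exact mul_le_mul_of_nonneg_left (integral_norm_trPair_le s a b) hM0
    _ = _ := by ring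

/-- The form is antilinear in `b`, which enters through its adjoint. -/
theorem exists_integral_mul_trPair_eq (s a : HSSpace (L2 d)) {u : PhaseSpace d → ℂ}
    (hu : Continuous u) {M : ℝ} (hM : ∀ z, ‖u z‖ ≤ M) :
    ∃ L : HSSpace (L2 d) →L⋆[ℂ] ℂ,
      ∀ b, L b = ∫ z, u z * trPair (opSTFT s.op a.op) (opSTFT s.op b.op) z := by
  have hi : ∀ b : HSSpace (L2 d),
      Integrable fun z => u z * trPair (opSTFT s.op a.op) (opSTFT s.op b.op) z :=
    fun b => (integrable_trPair s a b).bdd_mul hu.aestronglyMeasurable (Eventually.of_forall hM)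
  let l : HSSpace (L2 d) →ₗ⋆[ℂ] ℂ :=
    { toFun := fun b => ∫ z, u z * trPair (opSTFT s.op a.op) (opSTFT s.op b.op) z
      map_add' := fun b b' => by
        rw [← integral_add (hi b) (hi b')]
        refine integral_congr_ae (Eventually.of_forall fun z => ?_)
        simp only [trPair_opSTFT, map_add, inner_add_left, mul_add]
      map_smul' := fun c b => by
        rw [smul_eq_mul, ← integral_const_mul]
        refine integral_congr_ae (Eventually.of_forall fun z => ?_)
        simp only [trPair_opSTFT, map_smul, inner_smul_left]
        ring }
  exact ⟨l.mkContinuous (M * ‖s‖ ^ 2 * ‖a‖) fun b => norm_integral_mul_trPair_le s a b hM,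
    fun b => rfl⟩

/-- The forms `(ψ, φ) ↦ ∫ (F * χ_N) tr(ψ φ*)` are bounded uniformly in `N`. -/
theorem ToeplitzDefined.exists_forms {F : 𝓢'(PhaseSpace d, ℂ)} (hF : IsMild F)
    {s : HSSpace (L2 d)} (hFS : ToeplitzDefined F s.op) {χ : 𝓢(PhaseSpace d, ℂ)}
    (hχ : ∫ t, χ t = 1) (a : HSSpace (L2 d)) :
    ∃ L : ℕ → HSSpace (L2 d) →L⋆[ℂ] ℂ,
      (∀ k b, L k b
        = ∫ z, regularization F χ k z * trPair (opSTFT s.op a.op) (opSTFT s.op b.op) z) ∧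
      ∃ C, ∀ k, ‖L k‖ ≤ C := by
  choose M hM using exists_norm_regularization_le hF χ
  choose L hL using fun k =>
    exists_integral_mul_trPair_eq s a (continuous_regularization F χ k) (hM k)
  refine ⟨L, hL, ?_⟩
  rcases hFS with hFb | hFS
  · obtain ⟨C, hC⟩ := hFb.exists_norm_regularization_le χ
    have hC0 : 0 ≤ C := (norm_nonneg _).trans (hC 0 0)
    refine ⟨C * ‖s‖ ^ 2 * ‖a‖, fun k => (L k).opNorm_le_bound (by positivity) fun b => ?_⟩
    rw [hL]
    exact norm_integral_mul_trPair_le s a b (hC k)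
  -- For each `b` the values converge by hypothesis, hence are bounded in `k`.
  · refine banach_steinhaus fun b => ?_
    obtain ⟨c, hc⟩ := hFS _ ⟨a.op, a.isHilbertSchmidt_op, rfl⟩ _ ⟨b.op, b.isHilbertSchmidt_op, rfl⟩
    obtain ⟨C, hC⟩ := (hc.2 χ hχ).norm.bddAbove_range
    exact ⟨C, fun k => hL k b ▸ hC ⟨k, rfl⟩⟩

/-- The approximating forms are bounded uniformly in `k` and the limit form is continuous, so
convergence on `D` extends to every `b`. This is applied with `D` the shifted rank one operators and
with `D` the given family. -/
theorem hasDistribIntegral_of_dense_span {F : 𝓢'(PhaseSpace d, ℂ)} (hF : IsMild F)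
    {s : HSSpace (L2 d)} (hFS : ToeplitzDefined F s.op) {a : HSSpace (L2 d)} {lam : ℂ}
    {D : Set (HSSpace (L2 d))} (hD : Dense (Submodule.span ℂ D : Set (HSSpace (L2 d))))
    (h : ∀ b ∈ D, HasDistribIntegral F (trPair (opSTFT s.op a.op) (opSTFT s.op b.op))
      (lam * gaborInner (opSTFT s.op a.op) (opSTFT s.op b.op))) (b : HSSpace (L2 d)) :
    HasDistribIntegral F (trPair (opSTFT s.op a.op) (opSTFT s.op b.op))
      (lam * gaborInner (opSTFT s.op a.op) (opSTFT s.op b.op)) := by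
  refine ⟨integrable_trPair s a b, fun χ hχ => ?_⟩
  obtain ⟨L, hL, C, hC⟩ := hFS.exists_forms hF hχ a
  let l : HSSpace (L2 d) →L⋆[ℂ] ℂ := (lam * (‖s‖ : ℂ) ^ 2) • (innerSL ℂ).flip a
  have hl : ∀ b, l b = lam * gaborInner (opSTFT s.op a.op) (opSTFT s.op b.op) := fun b => by
    rw [gaborInner_opSTFT, ← mul_assoc]
    rfl
  simp_rw [← hL, ← hl]
  refine tendsto_of_dense_span hC hD (fun b hb => ?_) b
  rw [hl]
  simp_rw [hL]
  exact (h b hb).2 χ hχ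

theorem inner_compLeft_left {H : Type*} [NormedAddCommGroup H] [InnerProductSpace ℂ H]
    [CompleteSpace H] (A : H →L[ℂ] H) (b c : HSSpace H) :
    ⟪HSSpace.compLeft A b, c⟫_ℂ = ⟪b, HSSpace.compLeft A.adjoint c⟫_ℂ := by
  rw [lp.inner_eq_tsum, lp.inner_eq_tsum]
  refine tsum_congr fun i => ?_
  rw [HSSpace.compLeft_apply, HSSpace.compLeft_apply, ContinuousLinearMap.adjoint_inner_right]

/-- The rank one operators `|π(z) S g⟩⟨f|`. -/
def shiftedRankOnes (s : HSSpace (L2 d)) : Set (HSSpace (L2 d)) :=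
  {r | ∃ (z : PhaseSpace d) (f g : L2 d),
    ∀ b, ⟪r, b⟫_ℂ = ⟪timeFreqShift z (s.op g), b.op f⟫_ℂ}

theorem exists_mem_shiftedRankOnes (s : HSSpace (L2 d)) (z : PhaseSpace d) (f g : L2 d) :
    ∃ r ∈ shiftedRankOnes s, ∀ b, ⟪r, b⟫_ℂ = ⟪timeFreqShift z (s.op g), b.op f⟫_ℂ := by
  obtain ⟨r, hr⟩ := exists_inner_eq_inner_op (timeFreqShift z (s.op g)) f
  exact ⟨r, ⟨z, f, g, hr⟩, hr⟩

/-- If `b` is orthogonal to all of them, then `b f` is orthogonal to every `π(z) S e_i`. Choosing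
`i` with `S e_i ≠ 0`, Moyal forces `b f = 0`. -/
theorem dense_span_shiftedRankOnes {s : HSSpace (L2 d)} (hs : s ≠ 0) :
    Dense (Submodule.span ℂ (shiftedRankOnes s) : Set (HSSpace (L2 d))) := by
  rw [Submodule.dense_iff_topologicalClosure_eq_top, Submodule.topologicalClosure_eq_top_iff,
    Submodule.eq_bot_iff]
  intro b hb
  obtain ⟨i, hi⟩ : ∃ i, s i ≠ 0 := by
    by_contra! h
    exact hs (lp.ext (funext h))
  have hbf : ∀ f, b.op f = 0 := fun f => by
    refine inner_timeFreqShift_eq_zero_imp hi fun z => ?_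
    obtain ⟨r, hr, hrb⟩ := exists_mem_shiftedRankOnes s z f (onb (L2 d) i)
    rw [HSSpace.op_onb] at hrb
    rw [← hrb]
    exact (Submodule.mem_orthogonal _ _).1 hb r (Submodule.subset_span hr)
  refine lp.ext (funext fun i => ?_)
  rw [← HSSpace.op_onb b, hbf]
  rfl

theorem tr_op_comp_adjoint_self (s : HSSpace (L2 d)) :
    tr (s.op ∘L s.op.adjoint) = (‖s‖ : ℂ) ^ 2 := by
  rw [tr_op_comp_adjoint, inner_self_eq_norm_sq_to_K]
  rfl

/-- Moving `S* π(z')*` across the inner product leaves `r` paired with `π(z') S S* π(z')* a`, and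
the rank one form of `r` then produces the kernel. -/
theorem inner_kernel_comp {s r a : HSSpace (L2 d)} {z : PhaseSpace d} {f g : L2 d}
    (hr : ∀ b, ⟪r, b⟫_ℂ = ⟪timeFreqShift z (s.op g), b.op f⟫_ℂ) (z' : PhaseSpace d) :
    ⟪g, (kernel s.op z z' ∘L opSTFT s.op a.op z') f⟫_ℂ
      = ((‖s‖ : ℂ) ^ 2)⁻¹ * trPair (opSTFT s.op a.op) (opSTFT s.op r.op) z' := by
  rw [trPair_opSTFT, hsSTFT, inner_compLeft_left, hr, HSSpace.op_compLeft, HSSpace.op_compLeft,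
    kernel, tr_op_comp_adjoint_self]
  simp [inner_smul_right, ContinuousLinearMap.adjoint_inner_right, opSTFT,
    ContinuousLinearMap.adjoint_comp]

/-- For `lam = 1` this is the reproducing property of `kernel`, in weak form. -/
theorem inner_smul_opSTFT_apply {s r a : HSSpace (L2 d)} (hs : s ≠ 0) {z : PhaseSpace d}
    {f g : L2 d} (hr : ∀ b, ⟪r, b⟫_ℂ = ⟪timeFreqShift z (s.op g), b.op f⟫_ℂ) (lam : ℂ) :
    ⟪g, (lam • opSTFT s.op a.op) z f⟫_ℂ = ((‖s‖ : ℂ) ^ 2)⁻¹ *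
      (lam * gaborInner (opSTFT s.op a.op) (opSTFT s.op r.op)) := by
  have hs' : (‖s‖ : ℂ) ≠ 0 := by simpa using hs
  rw [gaborInner_opSTFT, hr]
  simp only [Pi.smul_apply, smul_apply, inner_smul_right, opSTFT,
    ContinuousLinearMap.comp_apply, ContinuousLinearMap.adjoint_inner_right]
  field_simp

/-- The definition of the Toeplitz image only tests against shifted rank one operators; density
upgrades this to arbitrary Hilbert–Schmidt `b`, in particular to members of the family. -/
theorem isToeplitzImage_smul_iff {F : 𝓢'(PhaseSpace d, ℂ)} (hF : IsMild F)
    {s : HSSpace (L2 d)} (hs : s ≠ 0) (hFS : ToeplitzDefined F s.op) (a : HSSpace (L2 d))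
    (lam : ℂ) :
    IsToeplitzImage F s.op (opSTFT s.op a.op) (lam • opSTFT s.op a.op) ↔
      ∀ b : HSSpace (L2 d), HasDistribIntegral F (trPair (opSTFT s.op a.op) (opSTFT s.op b.op))
        (lam * gaborInner (opSTFT s.op a.op) (opSTFT s.op b.op)) := by
  have hs' : (‖s‖ : ℂ) ^ 2 ≠ 0 := by simpa using hs
  constructor
  · intro h
    refine hasDistribIntegral_of_dense_span hF hFS (dense_span_shiftedRankOnes hs) ?_
    rintro r ⟨z, f, g, hr⟩
    have := (h z f g).const_mul ((‖s‖ : ℂ) ^ 2)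
    simp_rw [inner_kernel_comp hr, inner_smul_opSTFT_apply hs hr, mul_inv_cancel_left₀ hs'] at this
    exact this
  · intro h z f g
    obtain ⟨r, -, hr⟩ := exists_mem_shiftedRankOnes s z f g
    simp_rw [inner_kernel_comp hr, inner_smul_opSTFT_apply hs hr]
    exact (h r).const_mul _

theorem opSTFT_smul_add (S : L2 d →L[ℂ] L2 d) (c : ℂ) (a b : HSSpace (L2 d)) :
    opSTFT S (c • a + b).op = c • opSTFT S a.op + opSTFT S b.op := by
  funext z
  rw [HSSpace.op_smul_add]
  ext1 f
  simp [opSTFT]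

/-- `T ↦ 𝔙_S T` on Hilbert–Schmidt operators, as a linear map. -/
def opSTFTLM (S : L2 d →L[ℂ] L2 d) :
    HSSpace (L2 d) →ₗ[ℂ] (PhaseSpace d → L2 d →L[ℂ] L2 d) where
  toFun a := opSTFT S a.op
  map_add' a b := by simpa using opSTFT_smul_add S 1 a b
  map_smul' c a := by
    have h0 : opSTFT S (0 : HSSpace (L2 d)).op = 0 := by
      simpa using opSTFT_smul_add S (-1) (0 : HSSpace (L2 d)) 0
    simpa [h0] using opSTFT_smul_add S c a 0

theorem IsCompleteFamily.dense_span {κ : Type*} {s : HSSpace (L2 d)} (hs : s ≠ 0)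
    {b : κ → HSSpace (L2 d)}
    (h : IsCompleteFamily s.op fun n => opSTFT s.op (b n).op) :
    Dense (Submodule.span ℂ (Set.range b) : Set (HSSpace (L2 d))) := by
  rw [Metric.dense_iff]
  intro a ε hε
  have hs' : 0 < ‖s‖ := norm_pos_iff.2 hs
  -- `𝔙_S` multiplies squared norms by `‖s‖²`, so this tolerance means distance below `ε` between
  -- the operators.
  obtain ⟨φ, hφ, hlt⟩ := h _ ⟨a.op, a.isHilbertSchmidt_op, rfl⟩ (‖s‖ ^ 2 * ε ^ 2) (by positivity)
  have hr : (Set.range fun n => opSTFT s.op (b n).op) = opSTFTLM s.op '' Set.range b := by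
    rw [← Set.range_comp]
    rfl
  rw [hr, ← Submodule.map_span] at hφ
  obtain ⟨c, hc, rfl⟩ := hφ
  have e : opSTFT s.op a.op - opSTFTLM s.op c = opSTFT s.op (a - c).op :=
    ((opSTFTLM s.op).map_sub a c).symm
  rw [e, gaborInner_opSTFT, inner_self_eq_norm_sq_to_K, RCLike.ofReal_eq_complex_ofReal,
    ← Complex.ofReal_pow, ← Complex.ofReal_pow, ← Complex.ofReal_mul, Complex.ofReal_re,
    mul_lt_mul_iff_right₀ (by positivity)] at hlt
  refine ⟨c, ?_, hc⟩
  rw [Metric.mem_ball, dist_comm, dist_eq_norm]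
  exact lt_of_pow_lt_pow_left₀ 2 hε.le hlt

/-- Against each `F_m` the two orthogonality relations give `∫ F tr(F_n F_m*) = c_n ⟨F_n, F_m⟩`, and
the family spans a dense subspace. -/
theorem IsDoublyOrthogonal.isToeplitzImage_smul {κ : Type*} [DecidableEq κ]
    {F : 𝓢'(PhaseSpace d, ℂ)} (hF : IsMild F) {s : HSSpace (L2 d)} (hs : s ≠ 0)
    (hFS : ToeplitzDefined F s.op) {b : κ → HSSpace (L2 d)} {c : κ → ℂ}
    (h : IsDoublyOrthogonal F s.op (fun n => opSTFT s.op (b n).op) c) (n : κ) :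
    IsToeplitzImage F s.op (opSTFT s.op (b n).op) (c n • opSTFT s.op (b n).op) := by
  rw [isToeplitzImage_smul_iff hF hs hFS]
  refine hasDistribIntegral_of_dense_span hF hFS (h.1.dense_span hs) ?_
  rintro _ ⟨m, rfl⟩
  have h2 := h.2.2 n m
  rw [gaborInner, h.2.1 n m, mul_ite, mul_one, mul_zero]
  exact h2

/-- Disposes of `S = 0`: the space is then trivial and cannot contain a normalized function. -/
theorem ne_zero_of_gaborInner_eq_one {s a b : HSSpace (L2 d)}
    (h : gaborInner (opSTFT s.op a.op) (opSTFT s.op b.op) = 1) : s ≠ 0 := by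
  rintro rfl
  simp [gaborInner_opSTFT] at h

end Toeplitz

end

end QGabor

theorem mainTheorem9 (d : ℕ)
    (S : QGabor.L2 d →L[ℂ] QGabor.L2 d) (hS : QGabor.IsHilbertSchmidt S)
    (F : TemperedDistribution (QGabor.PhaseSpace d) ℂ) (hF : F ∈ QGabor.FG (Fin d ⊕ Fin d))
    (hFS : QGabor.ToeplitzDefined F S)
    (Fn : (Fin d → ℕ) → QGabor.PhaseSpace d → QGabor.L2 d →L[ℂ] QGabor.L2 d)
    (hFn : ∀ n, Fn n ∈ QGabor.quantumGaborSpace S) :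
    (QGabor.IsToeplitzEigenbasis F S Fn ↔
      ∃ c : (Fin d → ℕ) → ℂ, QGabor.IsDoublyOrthogonal F S Fn c) ∧
    ∀ c : (Fin d → ℕ) → ℂ, QGabor.IsDoublyOrthogonal F S Fn c →
      ∀ (n : Fin d → ℕ) (lam : ℂ),
        QGabor.IsToeplitzImage F S (Fn n) (lam • Fn n) ↔ lam = c n := by
  obtain ⟨s, rfl⟩ := hS.exists_op_eq
  obtain ⟨b, rfl⟩ : ∃ b : (Fin d → ℕ) → QGabor.HSSpace (QGabor.L2 d),
      Fn = fun n => QGabor.opSTFT s.op (b n).op := by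
    choose T hT hFT using hFn
    choose b hb using fun n => (hT n).exists_op_eq
    exact ⟨b, funext fun n => by rw [hb, hFT n]⟩
  have hmild := hF.1
  refine ⟨⟨fun h => ?_, fun ⟨c, hc⟩ => ?_⟩, fun c hc n lam => ⟨fun h => ?_, fun h => ?_⟩⟩
  -- The index `0` exists for every `d`, including `d = 0`, so some member of the family has norm
  -- one.
  · have hs := QGabor.ne_zero_of_gaborInner_eq_one ((h.1 0 0).trans (if_pos rfl))
    choose lam hlam using h.2.2
    refine ⟨lam, h.2.1, h.1, fun n m => ?_⟩
    have := (QGabor.isToeplitzImage_smul_iff hmild hs hFS (b n) (lam n)).1 (hlam n) (b m)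
    rw [h.1 n m, mul_ite, mul_one, mul_zero] at this
    exact this
  · have hs := QGabor.ne_zero_of_gaborInner_eq_one ((hc.2.1 0 0).trans (if_pos rfl))
    exact ⟨hc.2.1, hc.1, fun n => ⟨c n, hc.isToeplitzImage_smul hmild hs hFS n⟩⟩
  · have hnn : QGabor.gaborInner (QGabor.opSTFT s.op (b n).op) (QGabor.opSTFT s.op (b n).op) = 1 :=
      (hc.2.1 n n).trans (if_pos rfl)
    have hs := QGabor.ne_zero_of_gaborInner_eq_one hnn
    -- Testing the eigenvalue equation against `F_n` itself gives `∫ F tr(F_n F_n*) = lam`, while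
    -- double orthogonality gives `c n`.
    have h1 := (QGabor.isToeplitzImage_smul_iff hmild hs hFS (b n) lam).1 h (b n)
    have h2 := hc.2.2 n n
    rw [hnn, mul_one] at h1
    rw [if_pos rfl] at h2
    exact h1.unique h2
  · have hs := QGabor.ne_zero_of_gaborInner_eq_one ((hc.2.1 n n).trans (if_pos rfl))
    subst h
    exact hc.isToeplitzImage_smul hmild hs hFS n
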